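/- **Conventions.** A category $\mathcal{S}$ is *lextensive* if it has finite limits and finite coproducts and, for all objects $X,Y$, the functor $\mathcal{S}_{/X}\times\mathcal{S}_{/Y}\to\mathcal{S}_{/(X\amalg Y)}$, $(A,B)\mapsto A\amalg B$, is an equivalence; write $\mathbf{0}$ and $\mathbf{1}$ for its initial and final objects. It *has complements* if for every subobject $Y\subset X$ there is a subobject $Y'\subset X$ such that $Y\amalg Y'\to X$ is an isomorphism. An *ordered object* is an object $X$ with a subobject $R\subset X\times X$ such that $R\amalg\Delta_X\amalg R^{\mathrm{op}}\to X\times X$ is an isomorphism and $R_{12}\cap R_{23}\subset R_{13}$ in $X^3$; for $a,b\colon T\to X$ write $a<b$ if $(a,b)$ factors through $R$. For $n\ge 0$, $X^{(n)}\subset X^n$ is the intersection over $i<j$ of the inverse images of $R$ under the projections $X^n\to X^2$ to the coordinates $i,j$, and $X$ is *finite-like* if $X^{(n)}=\mathbf{0}$ for some $n\ge 0$. A morphism $f\colon X\to Y$ of ordered objects is *monotonic* if $f\times f$ maps $R_X$ into $R_Y$; isomorphisms of ordered objects are those in the category of ordered objects and monotonic morphisms. A subobject of $\mathbf{1}$ has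 a unique order (with $R=\mathbf{0}$). The *lexicographic sum* of ordered objects $X_1,\dots,X_n$ is $X_1\amalg\cdots\amalg X_n$ with the following order: for $a,b\colon T\to X_1\amalg\cdots\amalg X_n$ put $T_{ij}=a^{-1}(X_i)\cap b^{-1}(X_j)$; then $a<b$ if $a|_{T_{ii}}<b|_{T_{ii}}$ in $X_i$ for all $i$, and $T_{ij}=\mathbf{0}$ for all $i>j$. **(1)** Let $\mathcal{S}$ be a lextensive category that has complements, let $X$ be an ordered object of $\mathcal{S}$, and let $n\ge 0$. Then $X^{(n+1)}=\mathbf{0}$ if and only if $X$ is isomorphic to a lexicographic sum $X_1\sqcup\cdots\sqcup X_n$, where $X_n\subset\cdots\subset X_1\subset\mathbf{1}$ are subobjects of the final object equipped with their unique orders. **Further conventions.** Let $k$ be a field and let $\mathfrak{T}$ be a Karoubian (idempotent complete) tensor category over $k$, i.e. an additive $k$-linear category with a $k$-bilinear symmetric monoidal structure, with unit $\mathbb{1}$; put $\Gamma(A)=\mathrm{Hom}(\mathbb{1},A)$. A commutative algebra $A$ in $\mathfrak{T}$ with multiplication $m_A$ and unit $\eta_A$ is *étale* if its underlying object is rigid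 and the pairing $\epsilon_A\circ m_A\colon A\otimes A\to\mathbb{1}$ is perfect, where $\epsilon_A\colon A\to\mathbb{1}$ is the trace map, which sends $x$ to the trace of multiplication by $x$. For a homomorphism $f\colon A\to B$ of étale algebras let $f^\vee\colon B\to A$ be its dual with respect to these pairings; $f$ is *uniform* if $A\neq 0$ and $f^\vee\circ\eta_B\in k\cdot\eta_A\subset\Gamma(A)$. An *ordered étale algebra* $A$ is an ordered object of the opposite of the category of étale algebras in $\mathfrak{T}$ (this opposite category is lextensive, its initial object is the zero algebra $0$ and its final object is $\mathbb{1}$). Its order, as a subobject of $A\otimes A$ in the opposite category, is $A^{(2)}$; the two projections to $A$ correspond to homomorphisms $\pi^1_A,\pi^2_A\colon A\to A^{(2)}$. $A$ is *Delannic* if it is zero, or if $\eta_A\colon\mathbb{1}\to A$, $\pi_A^1$ and $\pi_A^2$ are all uniform. **(2)** Let $A$ be a finite-like Delannic ordered étale algebra in $\mathfrak{T}$. Then $A$ is isomorphic, as an ordered étale algebra, to $0$ or to $\mathbb{1}$ (each with its unique order). -/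

import Mathlib

open CategoryTheory CategoryTheory.Limits MonoidalCategory Opposite MonObj

namespace OrderedEtale

universe w v u

section Lextensive

variable {C : Type u} [Category.{v} C]

/-- A category has complements if every subobject `f : Y ⟶ X` has a complementary
subobject `g : Y' ⟶ X`, i.e. the natural map `Y ⨿ Y' ⟶ X` is an isomorphism. -/
def HasComplements (C : Type u) [Category.{v} C] : Prop :=
  ∀ {X Y : C} (f : Y ⟶ X) [Mono f], ∃ (Y' : C) (g : Y' ⟶ X),
    Mono g ∧ Nonempty (IsColimit (BinaryCofan.mk f g))

/-- The three maps `iᵣ : Aᵣ ⟶ P` exhibit `P` as the coproduct `A₁ ⨿ A₂ ⨿ A₃`. -/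
def IsTernaryCoproduct {A₁ A₂ A₃ P : C} (i₁ : A₁ ⟶ P) (i₂ : A₂ ⟶ P) (i₃ : A₃ ⟶ P) : Prop :=
  ∀ {T : C} (f₁ : A₁ ⟶ T) (f₂ : A₂ ⟶ T) (f₃ : A₃ ⟶ T),
    ∃! g : P ⟶ T, i₁ ≫ g = f₁ ∧ i₂ ≫ g = f₂ ∧ i₃ ≫ g = f₃

/-- A binary relation on `X`, i.e. a subobject `R` of `X × X`, given by its two components
`R ⟶ X`, which are jointly monic. -/
structure BinRel (X : C) where
  /-- the object `R` -/
  carrier : C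
  /-- the first component of `R ⟶ X × X` -/
  fst : carrier ⟶ X
  /-- the second component of `R ⟶ X × X` -/
  snd : carrier ⟶ X
  jointly_mono : ∀ {T : C} (f g : T ⟶ carrier),
    f ≫ fst = g ≫ fst → f ≫ snd = g ≫ snd → f = g

/-- The relation induced by `R` on `T`-points of `X`: `(a, b) : T ⟶ X × X` factors through `R`. -/
def BinRel.Lt {X : C} (R : BinRel X) {T : C} (a b : T ⟶ X) : Prop :=
  ∃ t : T ⟶ R.carrier, t ≫ R.fst = a ∧ t ≫ R.snd = b

/-- `R` is total if `R ⨿ Δ ⨿ Rᵒᵖ ⟶ X × X` is an isomorphism, where `Rᵒᵖ` is the image of `R`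
under the switching map (so it has the same carrier, with its two components exchanged). -/
def BinRel.IsTotal {X : C} (R : BinRel X) : Prop :=
  ∃ (c : BinaryFan X X) (hc : IsLimit c),
    IsTernaryCoproduct
      (hc.lift (BinaryFan.mk R.fst R.snd))
      (hc.lift (BinaryFan.mk (𝟙 X) (𝟙 X)))
      (hc.lift (BinaryFan.mk R.snd R.fst))

/-- `R` is transitive if `R₁₂ ∩ R₂₃ ⊆ R₁₃` as subobjects of `X × X × X`; here the containment is
expressed on `T`-points `(a, b, c)`. -/
def BinRel.IsTransitive {X : C} (R : BinRel X) : Prop :=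
  ∀ {T : C} (a b c : T ⟶ X), R.Lt a b → R.Lt b c → R.Lt a c

/-- A (totally) ordered object: an object with a total and transitive binary relation. -/
structure OrdObj (C : Type u) [Category.{v} C] where
  /-- the underlying object -/
  obj : C
  /-- the (strict) order -/
  rel : BinRel obj
  total : rel.IsTotal
  transitive : rel.IsTransitive

/-- A monotonic morphism of ordered objects: a map `f` with `R_X ⊆ (f × f)⁻¹(R_Y)`. -/
@[ext]
structure OrdHom (X Y : OrdObj C) where
  /-- the underlying morphism -/
  hom : X.obj ⟶ Y.obj
  monotonic : Y.rel.Lt (X.rel.fst ≫ hom) (X.rel.snd ≫ hom)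

/-- The category of ordered objects and monotonic morphisms. -/
instance : Category (OrdObj C) where
  Hom X Y := OrdHom X Y
  id X := ⟨𝟙 X.obj, 𝟙 _, by simp, by simp⟩
  comp f g := ⟨f.hom ≫ g.hom, by
    obtain ⟨s, hs₁, hs₂⟩ := f.monotonic
    obtain ⟨t, ht₁, ht₂⟩ := g.monotonic
    refine ⟨s ≫ t, ?_, ?_⟩
    · rw [Category.assoc, ht₁, ← Category.assoc, hs₁, Category.assoc]
    · rw [Category.assoc, ht₂, ← Category.assoc, hs₂, Category.assoc]⟩
  id_comp f := OrdHom.ext (Category.id_comp _)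
  comp_id f := OrdHom.ext (Category.comp_id _)
  assoc f g h := OrdHom.ext (Category.assoc _ _ _)

/-- The object `E` with the maps `x i : E ⟶ X` is the subobject `X^(n)` of `X^n` of strictly
increasing `n`-tuples, i.e. the intersection over `i < j` of the inverse images of the order under
the projections `X^n ⟶ X × X` to the coordinates `i` and `j`. This is expressed by the universal
property of that intersection. -/
structure IsIncreasingPower (X : OrdObj C) (n : ℕ) (E : C) (x : Fin n → (E ⟶ X.obj)) : Prop where
  lt : ∀ i j, i < j → X.rel.Lt (x i) (x j)
  existsUnique_lift : ∀ {T : C} (a : Fin n → (T ⟶ X.obj)),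
    (∀ i j, i < j → X.rel.Lt (a i) (a j)) → ∃! t : T ⟶ E, ∀ i, t ≫ x i = a i

/-- `X^(n) = 0`, where `0` is the initial object. -/
def OrdObj.PowerIsZero (X : OrdObj C) (n : ℕ) : Prop :=
  ∃ (E : C) (x : Fin n → (E ⟶ X.obj)), IsIncreasingPower X n E x ∧ Nonempty (IsInitial E)

/-- An ordered object is finite-like if `X^(n) = 0` for some `n`. -/
def OrdObj.IsFiniteLike (X : OrdObj C) : Prop := ∃ n : ℕ, X.PowerIsZero n

/-- The order on a subobject `Z` of the final object: the relation is the initial object `I`.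
(This is the only order on `Z`.) -/
def ordOfSubterminal {Z I : C} (hZ : IsSubterminal Z) (hI : IsInitial I)
    (hs : ∀ {T : C} (t : T ⟶ I), IsIso t) : OrdObj C where
  obj := Z
  rel :=
    { carrier := I
      fst := hI.to Z
      snd := hI.to Z
      jointly_mono := fun f g _ _ => by
        have := hs f
        exact (hI.ofIso (asIso f).symm).hom_ext f g }
  total := by
    refine ⟨BinaryFan.mk (𝟙 Z) (𝟙 Z),
      BinaryFan.IsLimit.mk _ (fun f _ => f) (fun f _ => Category.comp_id f)
        (fun f g => by simpa using hZ f g) (fun f _ m _ _ => hZ m f), ?_⟩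
    intro T f₁ f₂ f₃
    refine ⟨f₂, ⟨hI.hom_ext _ _, Category.id_comp f₂, hI.hom_ext _ _⟩, ?_⟩
    rintro g ⟨-, hg, -⟩
    exact (Category.id_comp g).symm.trans hg
  transitive := by
    rintro T a b c ⟨t, ht, -⟩ -
    exact ⟨t, hZ _ _, hZ _ _⟩

/-- A subobject of the final object, with its unique order. -/
noncomputable def subterminalOrd [HasTerminal C] [HasInitial C] [HasStrictInitialObjects C]
    (Y : Subobject (⊤_ C)) : OrdObj C :=
  ordOfSubterminal (Z := (Y : C))
    (fun _ _ _ => (cancel_mono Y.arrow).mp (Subsingleton.elim _ _))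
    initialIsInitial (fun t => initialIsInitial.isIso_to t)

/-- Let `X` be the coproduct of ordered objects `Y 0, …, Y (n - 1)`, with inclusions `inc i`, and let
`a, b : T ⟶ X`. Put `T i j = a⁻¹(Y i) ∩ b⁻¹(Y j)`. Then `a` is lexicographically smaller than `b`
if `a < b` on `T i i` in the order of `Y i`, for all `i`, and `T i j = 0` for all `j < i`.
Both conditions are tested on the maps `t : T' ⟶ T` that factor through `T i j`, i.e. for
which `t ≫ a` and `t ≫ b` factor through `Y i` and `Y j`, respectively. -/
def LexLt {n : ℕ} {X : C} {Y : Fin n → OrdObj C} (inc : ∀ i, (Y i).obj ⟶ X) {T : C}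
    (a b : T ⟶ X) : Prop :=
  (∀ (i : Fin n) (T' : C) (t : T' ⟶ T) (a' b' : T' ⟶ (Y i).obj),
    t ≫ a = a' ≫ inc i → t ≫ b = b' ≫ inc i → (Y i).rel.Lt a' b') ∧
  (∀ (i j : Fin n), j < i →
    ∀ (T' : C) (t : T' ⟶ T) (a' : T' ⟶ (Y i).obj) (b' : T' ⟶ (Y j).obj),
      t ≫ a = a' ≫ inc i → t ≫ b = b' ≫ inc j → Nonempty (IsInitial T'))

/-- The maps `inc i : Y i ⟶ X` exhibit the ordered object `X` as the lexicographic sum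
`Y 0 ⊔ ⋯ ⊔ Y (n - 1)`: it is the coproduct, and its order is the lexicographic one. -/
def IsLexSum {n : ℕ} (X : OrdObj C) (Y : Fin n → OrdObj C) (inc : ∀ i, (Y i).obj ⟶ X.obj) : Prop :=
  Nonempty (IsColimit (Cofan.mk X.obj inc)) ∧
  ∀ {T : C} (a b : T ⟶ X.obj), X.rel.Lt a b ↔ LexLt inc a b

end Lextensive

section Tensor

variable {𝔗 : Type u} [Category.{v} 𝔗] [MonoidalCategory 𝔗] [SymmetricCategory 𝔗]

/-- The trace map `A ⟶ 𝟙` of a rigid algebra `A` with dual `D`: it sends `x` to the trace of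
multiplication by `x` on `A`. -/
def traceMap (A : CommMon 𝔗) (D : 𝔗) [ExactPairing A.X D] : A.X ⟶ 𝟙_ 𝔗 :=
  (ρ_ A.X).inv ≫ A.X ◁ (η_ A.X D) ≫ (α_ A.X A.X D).inv ≫ μ[A.X] ▷ D ≫ (β_ A.X D).hom ≫ ε_ A.X D

/-- A commutative algebra is étale if it is rigid and the trace pairing `A ⊗ A ⟶ 𝟙`,
`(x, y) ↦ trace (x y)`, is perfect, i.e. is the evaluation of a duality between `A` and itself. -/
def IsEtale : ObjectProperty (CommMon 𝔗) := fun A =>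
  ∃ (D : 𝔗) (_ : ExactPairing A.X D) (p : ExactPairing A.X A.X),
    p.evaluation' = μ[A.X] ≫ traceMap A D

variable (𝔗) in
/-- The category of étale algebras and algebra homomorphisms. -/
abbrev Et : Type (max u v) := (IsEtale (𝔗 := 𝔗)).FullSubcategory

namespace Et

/-- The underlying object of an étale algebra. -/
abbrev X (A : Et 𝔗) : 𝔗 := A.obj.X

/-- The underlying map of a homomorphism of étale algebras. -/
abbrev map {A B : Et 𝔗} (f : A ⟶ B) : A.X ⟶ B.X := f.hom.hom.hom

/-- The self-duality of an étale algebra whose evaluation is the trace pairing. -/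
noncomputable abbrev selfDual (A : Et 𝔗) : ExactPairing A.X A.X :=
  A.property.choose_spec.choose_spec.choose

/-- The dual (adjoint) `f^∨ : B ⟶ A` of a map `f : A ⟶ B` of étale algebras, where `A` and `B` are
identified with their own duals through their trace pairings. -/
noncomputable def dualMap {A B : Et 𝔗} (f : A ⟶ B) : B.X ⟶ A.X :=
  (ρ_ B.X).inv ≫ B.X ◁ (A.selfDual.coevaluation' ≫ map f ▷ A.X) ≫ (α_ B.X B.X A.X).inv ≫
    B.selfDual.evaluation' ▷ A.X ≫ (λ_ A.X).hom

/-- The invariant `f^∨(1) : 𝟙 ⟶ A` of a map `f : A ⟶ B` of étale algebras. -/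
noncomputable def gammaTilde {A B : Et 𝔗} (f : A ⟶ B) : 𝟙_ 𝔗 ⟶ A.X := η[B.X] ≫ dualMap f

/-- A map `f : A ⟶ B` of étale algebras is uniform if `A` is non-zero and `f^∨(1)` belongs to
`k = k · η_A ⊆ Γ(A)`. -/
def IsUniform (k : Type w) [Field k] [Preadditive 𝔗] [Linear k 𝔗] {A B : Et 𝔗} (f : A ⟶ B) :
    Prop :=
  ¬ IsZero A.X ∧ ∃ c : k, gammaTilde f = c • η[A.X]

theorem isEtale_trivial : IsEtale (CommMon.trivial 𝔗) := by
  refine ⟨𝟙_ 𝔗, exactPairingUnit, exactPairingUnit, ?_⟩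
  change (ρ_ (𝟙_ 𝔗)).hom = (λ_ (𝟙_ 𝔗)).hom ≫ (ρ_ (𝟙_ 𝔗)).inv ≫ 𝟙_ 𝔗 ◁ (ρ_ (𝟙_ 𝔗)).inv ≫
    (α_ (𝟙_ 𝔗) (𝟙_ 𝔗) (𝟙_ 𝔗)).inv ≫ (λ_ (𝟙_ 𝔗)).hom ▷ 𝟙_ 𝔗 ≫ (β_ (𝟙_ 𝔗) (𝟙_ 𝔗)).hom ≫
      (ρ_ (𝟙_ 𝔗)).hom
  rw [braiding_tensorUnit_left]
  monoidal

variable (𝔗) in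
/-- The étale algebra `𝟙`. -/
def one : Et 𝔗 := ⟨CommMon.trivial 𝔗, isEtale_trivial⟩

/-- The unit `η_A : 𝟙 ⟶ A`, as a homomorphism of étale algebras. -/
def unitHom (A : Et 𝔗) : one 𝔗 ⟶ A := ObjectProperty.homMk (default : CommMon.trivial 𝔗 ⟶ A.obj)

theorem one_hom_ext {A : Et 𝔗} (f g : one 𝔗 ⟶ A) : f = g :=
  ObjectProperty.hom_ext _
    (Subsingleton.elim (α := CommMon.trivial 𝔗 ⟶ A.obj) f.hom g.hom)

section Zero

open scoped ZeroObject

variable [Preadditive 𝔗] [MonoidalPreadditive 𝔗] [HasZeroObject 𝔗]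

variable (𝔗) in
/-- The zero algebra. -/
noncomputable def zeroAlg : CommMon 𝔗 :=
  letI m : MonObj (0 : 𝔗) :=
    { one := 0
      mul := 0
      one_mul := (isZero_zero 𝔗).eq_of_tgt _ _
      mul_one := (isZero_zero 𝔗).eq_of_tgt _ _
      mul_assoc := (isZero_zero 𝔗).eq_of_tgt _ _ }
  { X := 0
    mon := m
    comm := ⟨(isZero_zero 𝔗).eq_of_tgt _ _⟩ }

theorem isEtale_zeroAlg : IsEtale (zeroAlg 𝔗) := by
  let p : ExactPairing (0 : 𝔗) (0 : 𝔗) :=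
    { coevaluation' := 0
      evaluation' := 0
      coevaluation_evaluation' := ((isZero_zero 𝔗).of_iso (ρ_ (0 : 𝔗))).eq_of_src _ _
      evaluation_coevaluation' := ((isZero_zero 𝔗).of_iso (λ_ (0 : 𝔗))).eq_of_src _ _ }
  have h : IsZero ((0 : 𝔗) ⊗ (0 : 𝔗)) := by
    rw [IsZero.iff_id_eq_zero, ← id_whiskerRight, (isZero_zero 𝔗).eq_of_src (𝟙 (0 : 𝔗)) 0,
      MonoidalPreadditive.zero_whiskerRight]
  exact ⟨0, p, p, h.eq_of_src _ _⟩

variable (𝔗) in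
/-- The étale algebra `0`. -/
noncomputable def zero : Et 𝔗 := ⟨zeroAlg 𝔗, isEtale_zeroAlg⟩

theorem isZero_zero_X : IsZero (zero 𝔗).X := isZero_zero 𝔗

variable (𝔗) in
/-- The zero algebra is the initial object of the opposite of the category of étale algebras. -/
noncomputable def isInitialZero : IsInitial (op (zero 𝔗)) :=
  IsInitial.ofUniqueHom
    (fun B => Quiver.Hom.op (ObjectProperty.homMk (CommMon.homMk
      { hom := (0 : B.unop.X ⟶ (zero 𝔗).X)
        isMonHom_hom :=
          { one_hom := isZero_zero_X.eq_of_tgt _ _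
            mul_hom := isZero_zero_X.eq_of_tgt _ _ } })))
    (fun _ _ => Quiver.Hom.unop_inj (ObjectProperty.hom_ext _
      (CommMon.hom_ext _ _ (isZero_zero_X.eq_of_tgt _ _))))

theorem isZero_of_zero_hom {B : Et 𝔗} (f : zero 𝔗 ⟶ B) : IsZero B.X := by
  have h : η[B.X] = 0 := by
    have h₁ : η[(zero 𝔗).X] ≫ map f = η[B.X] := IsMonHom.one_hom (f := f.hom.hom.hom)
    rw [← h₁, (isZero_zero_X (𝔗 := 𝔗)).eq_of_tgt η[(zero 𝔗).X] 0, zero_comp]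
  rw [IsZero.iff_id_eq_zero]
  have h₂ := MonObj.one_mul B.X
  rw [h, MonoidalPreadditive.zero_whiskerRight, zero_comp] at h₂
  rw [← Iso.inv_hom_id (λ_ B.X), ← h₂, comp_zero]

theorem isIso_to_zero {B : (Et 𝔗)ᵒᵖ} (t : B ⟶ op (zero 𝔗)) : IsIso t := by
  have hB : IsZero B.unop.X := isZero_of_zero_hom t.unop
  refine ⟨(isInitialZero 𝔗).to B, ?_, (isInitialZero 𝔗).hom_ext _ _⟩
  exact Quiver.Hom.unop_inj (ObjectProperty.hom_ext _
    (CommMon.hom_ext _ _ (hB.eq_of_tgt _ _)))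

end Zero

end Et

/-- An ordered étale algebra is an ordered object of the opposite of the category of
étale algebras. -/
abbrev OrdEt (𝔗 : Type u) [Category.{v} 𝔗] [MonoidalCategory 𝔗] [SymmetricCategory 𝔗] :=
  OrdObj (Et 𝔗)ᵒᵖ

namespace OrdEt

/-- The étale algebra underlying an ordered étale algebra. -/
abbrev alg (A : OrdEt 𝔗) : Et 𝔗 := A.obj.unop

/-- The étale algebra `A^(2)`, i.e. the order of `A` seen as an object. -/
abbrev alg₂ (A : OrdEt 𝔗) : Et 𝔗 := A.rel.carrier.unop

/-- The map `A ⟶ A^(2)` corresponding to the first projection. -/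
abbrev π₁ (A : OrdEt 𝔗) : A.alg ⟶ A.alg₂ := A.rel.fst.unop

/-- The map `A ⟶ A^(2)` corresponding to the second projection. -/
abbrev π₂ (A : OrdEt 𝔗) : A.alg ⟶ A.alg₂ := A.rel.snd.unop

/-- A non-zero ordered étale algebra `A` is Delannic if the unit `𝟙 ⟶ A` and the two maps
`A ⟶ A^(2)` are uniform; the zero algebra is Delannic too. -/
def IsDelannic (k : Type w) [Field k] [Preadditive 𝔗] [Linear k 𝔗] (A : OrdEt 𝔗) : Prop :=
  IsZero A.alg.X ∨
    (Et.IsUniform k A.alg.unitHom ∧ Et.IsUniform k A.π₁ ∧ Et.IsUniform k A.π₂)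

variable [Preadditive 𝔗] [MonoidalPreadditive 𝔗] [HasZeroObject 𝔗]

variable (𝔗) in
/-- The zero algebra with its unique order. -/
noncomputable def zero : OrdEt 𝔗 :=
  ordOfSubterminal (Z := op (Et.zero 𝔗))
    (fun _ _ _ => Quiver.Hom.unop_inj (ObjectProperty.hom_ext _
      (CommMon.hom_ext _ _ (Et.isZero_zero_X.eq_of_src _ _))))
    (Et.isInitialZero 𝔗) Et.isIso_to_zero

variable (𝔗) in
/-- The algebra `𝟙` with its unique order. -/
noncomputable def one : OrdEt 𝔗 :=
  ordOfSubterminal (Z := op (Et.one 𝔗))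
    (fun _ _ _ => Quiver.Hom.unop_inj (Et.one_hom_ext _ _))
    (Et.isInitialZero 𝔗) Et.isIso_to_zero

end OrdEt

end Tensor

end OrderedEtale

universe w u₁ v₁ u₂ v₂

/-!
The two halves of the theorem are independent; both rest on counting chains of `T`-points.

**Ordered objects of a lextensive category.** Since coproducts are stable under pullback, that an
object `T` is initial can be tested on the pieces of a finite decomposition of `T`
(`isInitial_of_cover`), and with complements an equality, an inequality or a factorization through
a subobject holds as soon as the pieces on which it fails are initial (`HasComplements.hom_ext`,
`HasComplements.exists_factor`). Hence one can argue with `T`-points as with elements of an ordered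
set. If `D ⊆ X` has no chains of length `n + 1`, the object of chains of length `n` in `D` is
subterminal, because two such chains with different entries could be spliced to a longer
one (`OrdObj.chain_unique`). Its last entry embeds it in `D`, and the complement has no chains
of length `n`; by induction on `n` the object `D` is a lexicographic sum of a decreasing sequence of
subobjects of the final object (`OrdObj.exists_decomposition`). Conversely, along a chain in such a
sum the index of the summand has to increase (`IsLexSum.isInitial_of_increasing`).

**Ordered étale algebras.** An étale algebra is the same as a commutative algebra with a linear form
whose pairing is perfect and whose copairing multiplies to `1`; the form is then the trace
(`IsSpecialForm`). In this description étale algebras are visibly stable under tensor products,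
finite products, and the direct factors that idempotents cut out. For an ordered étale algebra `A`
the algebra `A ⊗ A` is the product `A^(2) × A × A^(2)`, so that two points `a, b : A ⟶ T` determine
complementary idempotents of `T` that cut out the loci `a < b`, `a = b` and `b < a`
(`OrdEt.Comparison`).

Let `y` be the generic point `A ⟶ T ⊗ A`. The partial trace `T ⊗ A ⟶ T` is an integral over `y`:
it maps the idempotent of `a = y` to `1`, and that of `a < y` to the image under `a` of the
invariant of `A ⟶ A^(2)`, which is a constant `c ∈ k` if `A` is Delannic. Let `m ≥ 2` be such that
there are no chains of length `m + 1`, except over the zero algebra, and let `a₁ < ⋯ < aₘ` be a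
chain over `T`. Then `aₘ < y` is impossible, which gives `c = 0` in `T`; and `aₘ₋₁ < y` is
equivalent to `aₘ = y`, which gives `c = 1` in `T`. So `T = 0`, and there are no chains of
length `m` either (`OrdEt.NoChain.of_succ`). For a finite-like Delannic algebra this descends
to `m = 2`, so `A^(2) = 0`. Then the two maps `A ⟶ A ⊗ A` agree, and taking their partial traces
shows that the unit and the trace of `A` are inverse to each other if `A` is non-zero
(`OrdEt.nonempty_iso_one`).
-/

namespace OrderedEtale

universe v u v' u'

/-! ### Detecting initial objects locally -/

section Local

variable {C : Type u} [Category.{v} C] [FinitaryExtensive C]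

theorem isInitial_of_hom {I T : C} (hI : IsInitial I) (t : T ⟶ I) : Nonempty (IsInitial T) := by
  have := hI.isIso_to t
  exact ⟨hI.ofIso (asIso t).symm⟩

/-- An object mapping to a finite coproduct is initial as soon as all its pieces are. -/
theorem isInitial_of_cover [HasPullbacks C] {J : Type*} [Finite J] {F : Discrete J ⥤ C}
    {c : Cocone F} (hc : IsColimit c) {T : C} (f : T ⟶ c.pt)
    (h : ∀ i {T' : C} (s : T' ⟶ T) (u : T' ⟶ F.obj i), s ≫ f = u ≫ c.ι.app i →
      Nonempty (IsInitial T')) : Nonempty (IsInitial T) := by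
  let P : Discrete J → C := fun i => pullback f (c.ι.app i)
  let F' : Discrete J ⥤ C := Discrete.functor fun i => P ⟨i⟩
  let c' : Cocone F' := ⟨T, Discrete.natTrans fun i => pullback.fst f (c.ι.app i)⟩
  let α : F' ⟶ F := Discrete.natTrans fun i => pullback.snd f (c.ι.app i)
  obtain ⟨hc'⟩ := FinitaryPreExtensive.isUniversal_finiteCoproducts hc c' α f
    (by ext i; exact pullback.condition.symm) (NatTrans.Equifibered.of_discrete _)
    (fun i => IsPullback.of_hasPullback f (c.ι.app i))
  have hP : ∀ i, Nonempty (IsInitial (F'.obj i)) := fun i =>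
    h i (pullback.fst f (c.ι.app i)) (pullback.snd f (c.ι.app i)) pullback.condition
  refine ⟨IsInitial.ofUniqueHom
    (fun Y => hc'.desc ⟨Y, Discrete.natTrans fun i => (hP i).some.to Y⟩) fun Y m => ?_⟩
  exact hc'.hom_ext fun i => (hP i).some.hom_ext _ _

theorem isInitial_of_binaryCofan [HasPullbacks C] {A B P T : C} {i : A ⟶ P} {j : B ⟶ P}
    (hc : IsColimit (BinaryCofan.mk i j)) (f : T ⟶ P)
    (h₁ : ∀ {T' : C} (s : T' ⟶ T) (u : T' ⟶ A), s ≫ f = u ≫ i → Nonempty (IsInitial T'))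
    (h₂ : ∀ {T' : C} (s : T' ⟶ T) (u : T' ⟶ B), s ≫ f = u ≫ j → Nonempty (IsInitial T')) :
    Nonempty (IsInitial T) := by
  refine isInitial_of_cover hc f ?_
  rintro ⟨_ | _⟩ T' s u hu
  exacts [h₁ s u hu, h₂ s u hu]

theorem isInitial_of_inl_eq_inr {A B P T : C} {i : A ⟶ P} {j : B ⟶ P}
    (hc : IsColimit (BinaryCofan.mk i j)) (a : T ⟶ A) (b : T ⟶ B) (h : a ≫ i = b ≫ j) :
    Nonempty (IsInitial T) :=
  isInitial_of_hom initialIsInitial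
    ((FinitaryExtensive.isPullback_initial_to_binaryCofan hc).lift a b h)

theorem IsTernaryCoproduct.isColimit {A₁ A₂ A₃ P : C} {i₁ : A₁ ⟶ P} {i₂ : A₂ ⟶ P} {i₃ : A₃ ⟶ P}
    (h : IsTernaryCoproduct i₁ i₂ i₃) :
    Nonempty (IsColimit (BinaryCofan.mk i₁ (coprod.desc i₂ i₃))) := by
  refine ⟨BinaryCofan.IsColimit.mk _
    (fun f g => (h f (coprod.inl ≫ g) (coprod.inr ≫ g)).exists.choose)
    (fun f g => (h f (coprod.inl ≫ g) (coprod.inr ≫ g)).exists.choose_spec.1) ?_ ?_⟩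
  · intro T f g
    obtain ⟨-, h₂, h₃⟩ := (h f (coprod.inl ≫ g) (coprod.inr ≫ g)).exists.choose_spec
    refine coprod.hom_ext ?_ ?_
    · exact (coprod.inl_desc_assoc i₂ i₃ _).trans h₂
    · exact (coprod.inr_desc_assoc i₂ i₃ _).trans h₃
  · intro T f g m hm₁ hm₂
    refine (h f (coprod.inl ≫ g) (coprod.inr ≫ g)).unique ⟨hm₁, ?_, ?_⟩
      (h f (coprod.inl ≫ g) (coprod.inr ≫ g)).exists.choose_spec
    · rw [← hm₂]; exact (coprod.inl_desc_assoc i₂ i₃ _).symm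
    · rw [← hm₂]; exact (coprod.inr_desc_assoc i₂ i₃ _).symm

theorem IsTernaryCoproduct.isInitial_of_cover [HasPullbacks C] {A₁ A₂ A₃ P T : C} {i₁ : A₁ ⟶ P}
    {i₂ : A₂ ⟶ P} {i₃ : A₃ ⟶ P} (h : IsTernaryCoproduct i₁ i₂ i₃) (f : T ⟶ P)
    (h₁ : ∀ {T' : C} (s : T' ⟶ T) (u : T' ⟶ A₁), s ≫ f = u ≫ i₁ → Nonempty (IsInitial T'))
    (h₂ : ∀ {T' : C} (s : T' ⟶ T) (u : T' ⟶ A₂), s ≫ f = u ≫ i₂ → Nonempty (IsInitial T'))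
    (h₃ : ∀ {T' : C} (s : T' ⟶ T) (u : T' ⟶ A₃), s ≫ f = u ≫ i₃ → Nonempty (IsInitial T')) :
    Nonempty (IsInitial T) := by
  obtain ⟨hc⟩ := h.isColimit
  refine isInitial_of_binaryCofan hc f h₁ fun s u hu =>
    isInitial_of_binaryCofan (coprodIsCoprod A₂ A₃) u ?_ ?_
  · intro T' s' u' hu'
    have hu'' : s' ≫ u = u' ≫ coprod.inl := hu'
    exact h₂ (s' ≫ s) u' (by
      rw [Category.assoc, hu, reassoc_of% hu'', coprod.inl_desc])
  · intro T' s' u' hu'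
    have hu'' : s' ≫ u = u' ≫ coprod.inr := hu'
    exact h₃ (s' ≫ s) u' (by
      rw [Category.assoc, hu, reassoc_of% hu'', coprod.inr_desc])

/-- In a category with complements a monomorphism is invertible as soon as every object over its
target that is disjoint from it is initial. -/
theorem HasComplements.isIso_of_mono (hC : HasComplements C) {X Y : C} (f : Y ⟶ X) [Mono f]
    (h : ∀ {T : C} (x : T ⟶ X), (∀ {T' : C} (s : T' ⟶ T) (u : T' ⟶ Y), s ≫ x = u ≫ f →
      Nonempty (IsInitial T')) → Nonempty (IsInitial T)) : IsIso f := by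
  obtain ⟨Y', g, -, ⟨hc⟩⟩ := hC f
  obtain ⟨hY'⟩ := h g fun s u hu => isInitial_of_inl_eq_inr hc u s hu.symm
  exact (BinaryCofan.isColimit_iff_isIso_inl hY' _).1 ⟨hc⟩

/-- In a category with complements a map factors through a monomorphism as soon as every piece of
its source on which it is disjoint from the monomorphism is initial. -/
theorem HasComplements.exists_factor [HasPullbacks C] (hC : HasComplements C) {X Y T : C}
    (f : Y ⟶ X) [Mono f] (x : T ⟶ X)
    (h : ∀ {T' : C} (s : T' ⟶ T), (∀ {T'' : C} (t : T'' ⟶ T') (u : T'' ⟶ Y), t ≫ s ≫ x = u ≫ f →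
      Nonempty (IsInitial T'')) → Nonempty (IsInitial T')) : ∃ u : T ⟶ Y, u ≫ f = x := by
  have : IsIso (pullback.fst x f) := by
    refine hC.isIso_of_mono _ fun s hs => h s fun t u hu => ?_
    exact hs t (pullback.lift (t ≫ s) u (by rw [Category.assoc, hu])) (pullback.lift_fst _ _ _).symm
  exact ⟨inv (pullback.fst x f) ≫ pullback.snd x f, by simp [← pullback.condition]⟩

/-- In a category with complements two maps are equal as soon as every piece of their source on
which they agree nowhere is initial. -/
theorem HasComplements.hom_ext [HasEqualizers C] (hC : HasComplements C) {X T : C} {a b : T ⟶ X}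
    (h : ∀ {T' : C} (s : T' ⟶ T), (∀ {T'' : C} (t : T'' ⟶ T'), t ≫ s ≫ a = t ≫ s ≫ b →
      Nonempty (IsInitial T'')) → Nonempty (IsInitial T')) : a = b := by
  have : IsIso (equalizer.ι a b) := by
    refine hC.isIso_of_mono _ fun s hs => h s fun t ht => ?_
    exact hs t (equalizer.lift (t ≫ s) (by simpa using ht)) (equalizer.lift_ι _ _).symm
  exact eq_of_epi_equalizer

/-- In a category with complements, finitely many pairwise disjoint monomorphisms that exhaust their
common target exhibit it as a coproduct. -/
theorem HasComplements.isColimit_of_disjoint [HasFiniteLimits C] (hC : HasComplements C) {J : Type}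
    [Finite J] {X : C} {Y : J → C} (f : ∀ i, Y i ⟶ X) [∀ i, Mono (f i)]
    (hd : ∀ i j, i ≠ j → ∀ {T : C} (a : T ⟶ Y i) (b : T ⟶ Y j), a ≫ f i = b ≫ f j →
      Nonempty (IsInitial T))
    (he : ∀ {T : C} (x : T ⟶ X), (∀ i {T' : C} (s : T' ⟶ T) (u : T' ⟶ Y i), s ≫ x = u ≫ f i →
      Nonempty (IsInitial T')) → Nonempty (IsInitial T)) :
    Nonempty (IsColimit (Cofan.mk X f)) := by
  rw [Cofan.nonempty_isColimit_iff_isIso_sigmaDesc]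
  have hm : Mono (Sigma.desc f) := by
    refine ⟨fun {T} a b hab => ?_⟩
    refine hC.hom_ext fun {T'} s hs => ?_
    refine isInitial_of_cover (coproductIsCoproduct Y) (s ≫ a) fun i T₁ s₁ u hu => ?_
    refine isInitial_of_cover (coproductIsCoproduct Y) (s₁ ≫ s ≫ b) fun j T₂ s₂ v hv => ?_
    obtain ⟨i⟩ := i
    obtain ⟨j⟩ := j
    have hu' : s₁ ≫ s ≫ a = u ≫ Sigma.ι Y i := hu
    have hv' : s₂ ≫ s₁ ≫ s ≫ b = v ≫ Sigma.ι Y j := hv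
    have huv : (s₂ ≫ u) ≫ f i = v ≫ f j := by
      have h₁ : (u ≫ Sigma.ι Y i) ≫ Sigma.desc f = u ≫ f i := by simp
      have h₂ : (v ≫ Sigma.ι Y j) ≫ Sigma.desc f = v ≫ f j := by simp
      rw [Category.assoc, ← h₁, ← h₂, ← hu', ← hv']
      simp [hab]
    by_cases hij : i = j
    · subst hij
      refine hs (s₂ ≫ s₁) ?_
      have huv' : s₂ ≫ u = v := (cancel_mono (f i)).1 huv
      rw [Category.assoc, hu', Category.assoc, hv', ← huv', Category.assoc]
    · exact hd i j hij _ _ huv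
  have hi : IsIso (Sigma.desc f) :=
    hC.isIso_of_mono _ fun x hx => he x fun i T' s u hu =>
      hx s (u ≫ Sigma.ι Y i) (by simpa using hu)
  exact hi

end Local

/-! ### Orders on objects of a lextensive category -/

section Order

variable {C : Type u} [Category.{v} C]

theorem BinRel.Lt.precomp {X : C} {R : BinRel X} {T T' : C} {a b : T ⟶ X} (h : R.Lt a b)
    (s : T' ⟶ T) : R.Lt (s ≫ a) (s ≫ b) := by
  obtain ⟨t, rfl, rfl⟩ := h
  exact ⟨s ≫ t, Category.assoc _ _ _, Category.assoc _ _ _⟩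

/-- Any two points over an initial object are in relation. -/
theorem BinRel.lt_of_isInitial {X : C} (R : BinRel X) {T : C} (hT : IsInitial T) (a b : T ⟶ X) :
    R.Lt a b :=
  ⟨hT.to _, hT.hom_ext _ _, hT.hom_ext _ _⟩

/-- A family of points is increasing for a relation. -/
def BinRel.Increasing {X : C} (R : BinRel X) {n : ℕ} {T : C} (a : Fin n → (T ⟶ X)) : Prop :=
  ∀ i j, i < j → R.Lt (a i) (a j)

theorem BinRel.Increasing.precomp {X D : C} {R : BinRel X} {j : D ⟶ X} {n : ℕ} {T T' : C}
    {a : Fin n → (T ⟶ D)} (h : R.Increasing (fun i => a i ≫ j)) (s : T' ⟶ T) :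
    R.Increasing (fun i => (s ≫ a i) ≫ j) :=
  fun i j hij => by simpa using (h i j hij).precomp s

theorem BinRel.IsTransitive.le_trans {X : C} {R : BinRel X} (hR : R.IsTransitive) {T : C}
    {a b c : T ⟶ X} (h₁ : a = b ∨ R.Lt a b) (h₂ : R.Lt b c) : R.Lt a c := by
  rcases h₁ with rfl | h₁
  · exact h₂
  · exact hR _ _ _ h₁ h₂

theorem BinRel.Increasing.eq_or_lt {X : C} {R : BinRel X} {n : ℕ} {T : C} {a : Fin n → (T ⟶ X)}
    (h : R.Increasing a) {i j : Fin n} (hij : i ≤ j) : a i = a j ∨ R.Lt (a i) (a j) := by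
  rcases hij.eq_or_lt with rfl | hij
  · exact Or.inl rfl
  · exact Or.inr (h i j hij)

/-- If `b i < a i`, then `b 0 < ⋯ < b i < a i < ⋯ < a n` is a longer chain. -/
theorem BinRel.Increasing.splice {X D : C} {R : BinRel X} (hR : R.IsTransitive) {j : D ⟶ X} {n : ℕ}
    {T : C} {a b : Fin (n + 1) → (T ⟶ D)} (ha : R.Increasing (fun i => a i ≫ j))
    (hb : R.Increasing (fun i => b i ≫ j)) (i : Fin (n + 1)) (hi : R.Lt (b i ≫ j) (a i ≫ j)) :
    R.Increasing (fun k : Fin (n + 2) => (if h : k.val ≤ i.val then b ⟨k.val, by omega⟩ else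
      a ⟨k.val - 1, by omega⟩) ≫ j) := by
  intro k l hkl
  have hkl' : k.val < l.val := hkl
  by_cases hl : l.val ≤ i.val
  · have hk : k.val ≤ i.val := by omega
    simp only [hk, hl, dif_pos]
    exact hb _ _ hkl
  by_cases hk : k.val ≤ i.val
  · simp only [hk, hl, dif_pos, dif_neg, not_false_eq_true]
    have h₁ := hb.eq_or_lt (i := ⟨k.val, by omega⟩) (j := i) hk
    have h₂ := ha.eq_or_lt (i := i) (j := ⟨l.val - 1, by omega⟩) (Fin.le_def.2 (by simp; omega))
    have h₃ := hR.le_trans h₁ hi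
    rcases h₂ with h₂ | h₂
    · exact h₂ ▸ h₃
    · exact hR _ _ _ h₃ h₂
  · simp only [hk, hl, dif_neg, not_false_eq_true]
    exact ha _ _ (Fin.lt_def.2 (by simp; omega))

theorem BinRel.Increasing.snoc {X D : C} {R : BinRel X} (hR : R.IsTransitive) {j : D ⟶ X} {n : ℕ}
    {T : C} {a : Fin (n + 1) → (T ⟶ D)} (ha : R.Increasing (fun i => a i ≫ j)) {b : T ⟶ D}
    (hb : R.Lt (a (Fin.last n) ≫ j) (b ≫ j)) :
    R.Increasing (fun i => Fin.snoc (α := fun _ => T ⟶ D) a b i ≫ j) := by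
  intro k l hkl
  induction l using Fin.lastCases with
  | last =>
    induction k using Fin.lastCases with
    | last => exact absurd hkl (lt_irrefl _)
    | cast k =>
      simp only [Fin.snoc_castSucc, Fin.snoc_last]
      exact hR.le_trans (ha.eq_or_lt (Fin.le_last k)) hb
  | cast l =>
    induction k using Fin.lastCases with
    | last => exact absurd (hkl.trans (Fin.castSucc_lt_last l)) (lt_irrefl _)
    | cast k =>
      simp only [Fin.snoc_castSucc]
      exact ha k l (by simpa using hkl)

theorem isLimit_lift_fst {X Y T : C} {c : BinaryFan X Y} (hc : IsLimit c) (f : T ⟶ X) (g : T ⟶ Y) :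
    hc.lift (BinaryFan.mk f g) ≫ c.fst = f :=
  hc.fac _ _

theorem isLimit_lift_snd {X Y T : C} {c : BinaryFan X Y} (hc : IsLimit c) (f : T ⟶ X) (g : T ⟶ Y) :
    hc.lift (BinaryFan.mk f g) ≫ c.snd = g :=
  hc.fac _ _

theorem BinRel.mono_lift {X : C} (R : BinRel X) [HasBinaryProducts C] :
    Mono (prod.lift R.fst R.snd) :=
  ⟨fun f g hfg => R.jointly_mono f g
    (by simpa only [Category.assoc, prod.lift_fst] using hfg =≫ prod.fst)
    (by simpa only [Category.assoc, prod.lift_snd] using hfg =≫ prod.snd)⟩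

/-- The object of increasing `n`-tuples of points of a subobject `D` of `X`. -/
theorem exists_increasingPower [HasFiniteLimits C] {X D : C} (R : BinRel X) (j : D ⟶ X) (n : ℕ) :
    ∃ (E : C) (x : Fin n → (E ⟶ D)), R.Increasing (fun i => x i ≫ j) ∧
      (∀ {T : C} (a : Fin n → (T ⟶ D)), R.Increasing (fun i => a i ≫ j) →
        ∃ t : T ⟶ E, ∀ i, t ≫ x i = a i) ∧
      ∀ {T : C} (f g : T ⟶ E), (∀ i, f ≫ x i = g ≫ x i) → f = g := by
  have := R.mono_lift
  let I := {p : Fin n × Fin n // p.1 < p.2}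
  let f : (∏ᶜ fun _ : Fin n => D) ⟶ ∏ᶜ fun _ : I => X ⨯ X :=
    Pi.lift fun p => prod.lift (Pi.π _ p.1.1 ≫ j) (Pi.π _ p.1.2 ≫ j)
  let g : (∏ᶜ fun _ : I => R.carrier) ⟶ ∏ᶜ fun _ : I => X ⨯ X :=
    Pi.lift fun p => Pi.π _ p ≫ prod.lift R.fst R.snd
  have hg : Mono g := ⟨fun a b hab => Pi.hom_ext _ _ fun p => by
    rw [← cancel_mono (prod.lift R.fst R.snd)]
    simpa [g] using hab =≫ Pi.π _ p⟩
  refine ⟨pullback f g, fun i => pullback.fst f g ≫ Pi.π _ i, ?_, ?_, ?_⟩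
  · intro i k hik
    refine ⟨pullback.snd f g ≫ Pi.π _ ⟨(i, k), hik⟩, ?_, ?_⟩
    · have := pullback.condition (f := f) (g := g) =≫ (Pi.π _ ⟨(i, k), hik⟩ ≫ prod.fst)
      simpa [f, g, prod.lift_fst, prod.lift_snd] using this.symm
    · have := pullback.condition (f := f) (g := g) =≫ (Pi.π _ ⟨(i, k), hik⟩ ≫ prod.snd)
      simpa [f, g, prod.lift_fst, prod.lift_snd] using this.symm
  · intro T a ha
    choose t ht₁ ht₂ using ha
    refine ⟨pullback.lift (Pi.lift a) (Pi.lift fun p : I => t p.1.1 p.1.2 p.2) ?_,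
      fun i => by rw [pullback.lift_fst_assoc, Pi.lift_π]⟩
    refine Pi.hom_ext _ _ fun p => ?_
    ext <;> simp [f, g, ht₁, ht₂]
  · intro T a b hab
    rw [← cancel_mono (pullback.fst f g)]
    exact Pi.hom_ext _ _ fun i => by simpa using hab i

variable [FinitaryExtensive C]

namespace OrdObj

variable (X : OrdObj C)

theorem isInitial_of_lt_self {T : C} {a : T ⟶ X.obj} (h : X.rel.Lt a a) :
    Nonempty (IsInitial T) := by
  obtain ⟨c, hc, hX⟩ := X.total
  obtain ⟨t, ht₁, ht₂⟩ := h
  obtain ⟨hd⟩ := hX.isColimit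
  refine isInitial_of_inl_eq_inr hd t (a ≫ coprod.inl) ?_
  rw [Category.assoc, coprod.inl_desc]
  refine BinaryFan.IsLimit.hom_ext hc ?_ ?_
  · simp only [Category.assoc, isLimit_lift_fst]
    exact ht₁.trans (Category.comp_id a).symm
  · simp only [Category.assoc, isLimit_lift_snd]
    exact ht₂.trans (Category.comp_id a).symm

theorem isInitial_of_lt_of_lt {T : C} {a b : T ⟶ X.obj} (h₁ : X.rel.Lt a b)
    (h₂ : X.rel.Lt b a) : Nonempty (IsInitial T) :=
  X.isInitial_of_lt_self (X.transitive _ _ _ h₁ h₂)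

/-- To show that the source of two points is initial, one may assume that they compare. -/
theorem isInitial_of_trichotomy [HasPullbacks C] {T : C} (a b : T ⟶ X.obj)
    (h₁ : ∀ {T' : C} (s : T' ⟶ T), X.rel.Lt (s ≫ a) (s ≫ b) → Nonempty (IsInitial T'))
    (h₂ : ∀ {T' : C} (s : T' ⟶ T), s ≫ a = s ≫ b → Nonempty (IsInitial T'))
    (h₃ : ∀ {T' : C} (s : T' ⟶ T), X.rel.Lt (s ≫ b) (s ≫ a) → Nonempty (IsInitial T')) :
    Nonempty (IsInitial T) := by
  obtain ⟨c, hc, hX⟩ := X.total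
  refine hX.isInitial_of_cover (hc.lift (BinaryFan.mk a b)) ?_ ?_ ?_
  · intro T' s u hu
    have e₁ := hu =≫ c.fst
    have e₂ := hu =≫ c.snd
    simp only [Category.assoc, isLimit_lift_fst, isLimit_lift_snd] at e₁ e₂
    exact h₁ s ⟨u, e₁.symm, e₂.symm⟩
  · intro T' s u hu
    have e₁ := hu =≫ c.fst
    have e₂ := hu =≫ c.snd
    simp only [Category.assoc, isLimit_lift_fst, isLimit_lift_snd] at e₁ e₂
    exact h₂ s (e₁.trans e₂.symm)
  · intro T' s u hu
    have e₁ := hu =≫ c.fst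
    have e₂ := hu =≫ c.snd
    simp only [Category.assoc, isLimit_lift_fst, isLimit_lift_snd] at e₁ e₂
    exact h₃ s ⟨u, e₂.symm, e₁.symm⟩

variable {X}

/-- With complements, `a < b` can be proved by contradiction. -/
theorem lt_of_not_le [HasFiniteLimits C] (hC : HasComplements C) {T : C} {a b : T ⟶ X.obj}
    (h₂ : ∀ {T' : C} (s : T' ⟶ T), s ≫ a = s ≫ b → Nonempty (IsInitial T'))
    (h₃ : ∀ {T' : C} (s : T' ⟶ T), X.rel.Lt (s ≫ b) (s ≫ a) → Nonempty (IsInitial T')) :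
    X.rel.Lt a b := by
  have := X.rel.mono_lift
  obtain ⟨u, hu⟩ := hC.exists_factor (prod.lift X.rel.fst X.rel.snd) (prod.lift a b) fun s hs => by
    refine X.isInitial_of_trichotomy (s ≫ a) (s ≫ b) ?_ ?_ ?_
    · rintro T' t ⟨u, hu₁, hu₂⟩
      exact hs t u (by ext <;> simp [hu₁, hu₂])
    · exact fun t ht => h₂ (t ≫ s) (by simpa using ht)
    · exact fun t ht => h₃ (t ≫ s) (by simpa using ht)
  exact ⟨u, by simpa only [Category.assoc, prod.lift_fst] using hu =≫ prod.fst,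
    by simpa only [Category.assoc, prod.lift_snd] using hu =≫ prod.snd⟩

theorem eq_of_not_lt [HasFiniteLimits C] (hC : HasComplements C) {T : C} {a b : T ⟶ X.obj}
    (h₁ : ∀ {T' : C} (s : T' ⟶ T), X.rel.Lt (s ≫ a) (s ≫ b) → Nonempty (IsInitial T'))
    (h₃ : ∀ {T' : C} (s : T' ⟶ T), X.rel.Lt (s ≫ b) (s ≫ a) → Nonempty (IsInitial T')) :
    a = b :=
  hC.hom_ext fun s hs => X.isInitial_of_trichotomy (s ≫ a) (s ≫ b)
    (fun t ht => h₁ (t ≫ s) (by simpa using ht)) (fun t ht => hs t ht)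
    (fun t ht => h₃ (t ≫ s) (by simpa using ht))

end OrdObj

end Order

/-! ### Decomposing an ordered object without long chains -/

section Decomposition

variable {C : Type u} [Category.{v} C] [FinitaryExtensive C] [HasFiniteLimits C]

/-- Two chains of maximal length in a subobject of an ordered object are equal. -/
theorem OrdObj.chain_unique (hC : HasComplements C) (X : OrdObj C) {n : ℕ} {D T : C}
    (j : D ⟶ X.obj) [Mono j] {a b : Fin (n + 1) → (T ⟶ D)}
    (ha : X.rel.Increasing (fun i => a i ≫ j)) (hb : X.rel.Increasing (fun i => b i ≫ j))
    (h : ∀ {T : C} (c : Fin (n + 2) → (T ⟶ D)), X.rel.Increasing (fun i => c i ≫ j) →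
      Nonempty (IsInitial T)) (i : Fin (n + 1)) : a i = b i := by
  rw [← cancel_mono j]
  exact OrdObj.eq_of_not_lt hC
    (fun s hs => h _ ((hb.precomp s).splice X.transitive (ha.precomp s) i (by simpa using hs)))
    (fun s hs => h _ ((ha.precomp s).splice X.transitive (hb.precomp s) i (by simpa using hs)))

/-- A subobject `D` of an ordered object that contains no chain of length `n + 1` is the
lexicographic sum of the subobjects `D_0, …, D_{n-1}`, where `D_i` is the locus of
the elements of `D` that have exactly `i` elements of `D` below them. -/
theorem OrdObj.exists_decomposition (hC : HasComplements C) (X : OrdObj C) (n : ℕ) {D : C}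
    (j : D ⟶ X.obj) [Mono j]
    (h : ∀ {T : C} (c : Fin (n + 1) → (T ⟶ D)), X.rel.Increasing (fun i => c i ≫ j) →
      Nonempty (IsInitial T)) :
    ∃ W : Fin n → Over D,
      (∀ i, IsSubterminal (W i).left) ∧ (∀ i k, i ≤ k → Nonempty ((W k).left ⟶ (W i).left)) ∧
      (∀ {T : C} (x : T ⟶ D), (∀ i {T' : C} (s : T' ⟶ T) (u : T' ⟶ (W i).left),
        s ≫ x = u ≫ (W i).hom → Nonempty (IsInitial T')) → Nonempty (IsInitial T)) ∧
      (∀ i k, i < k → ∀ {T : C} (y : T ⟶ (W i).left) (z : T ⟶ (W k).left),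
        X.rel.Lt (y ≫ (W i).hom ≫ j) (z ≫ (W k).hom ≫ j)) ∧
      (∀ {T : C} (c : Fin n → (T ⟶ D)), X.rel.Increasing (fun i => c i ≫ j) →
        ∀ i, Nonempty (T ⟶ (W i).left)) := by
  induction n generalizing D with
  | zero =>
    refine ⟨fun i => i.elim0, fun i => i.elim0, fun i => i.elim0, fun {T} x _ => ?_,
      fun i => i.elim0, fun _ _ i => i.elim0⟩
    exact h (fun _ => x) fun i k hik => by omega
  | succ n ih =>
    obtain ⟨Z, z, hz, hz', hz''⟩ := exists_increasingPower X.rel j (n + 1)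
    have hZ : IsSubterminal Z := fun T f g => hz'' f g
      (X.chain_unique hC j (hz.precomp f) (hz.precomp g) h)
    have : Mono (z (Fin.last n)) := ⟨fun f g _ => hZ f g⟩
    obtain ⟨D', d, hd, ⟨hc⟩⟩ := hC (z (Fin.last n))
    -- a point disjoint from `Z` is in `D'`
    have hD' : ∀ {T : C} (x : T ⟶ D), (∀ {T' : C} (s : T' ⟶ T) (u : T' ⟶ Z),
        s ≫ x = u ≫ z (Fin.last n) → Nonempty (IsInitial T')) → ∃ y : T ⟶ D', y ≫ d = x := by
      intro T x hx
      refine hC.exists_factor d x fun s hs => isInitial_of_binaryCofan hc (s ≫ x) ?_ ?_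
      · exact fun t u hu => hx (t ≫ s) u (by simpa using hu)
      · exact fun t u hu => hs t u (by simpa using hu)
    obtain ⟨W, h₁, h₂, h₃, h₄, h₅⟩ := ih (d ≫ j) fun {T} c hc' => by
      obtain ⟨t, ht⟩ := hz' (fun i => c i ≫ d) (by simpa using hc')
      exact isInitial_of_inl_eq_inr hc t (c (Fin.last n)) (ht _)
    -- the elements of a chain of length `n + 1` other than the last one are in `D'`
    have hlow : ∀ {T : C} (c : Fin (n + 1) → (T ⟶ D)), X.rel.Increasing (fun i => c i ≫ j) →
        ∀ i, Nonempty (T ⟶ (W i).left) := by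
      intro T c hcc
      have hf : ∀ i : Fin n, ∃ y : T ⟶ D', y ≫ d = c i.castSucc := fun i => hD' _ fun s u hu => by
        refine h (Fin.snoc (α := fun _ => _ ⟶ D) (fun k => u ≫ z k) (s ≫ c (Fin.last n))) ?_
        refine (hz.precomp u).snoc X.transitive ?_
        rw [← hu]
        simpa using (hcc _ _ (Fin.castSucc_lt_last i)).precomp s
      choose y hy using hf
      refine h₅ y fun i k hik => ?_
      simpa [← Category.assoc, hy] using hcc i.castSucc k.castSucc hik
    refine ⟨Fin.snoc (α := fun _ => Over D) (fun i => Over.mk ((W i).hom ≫ d))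
      (Over.mk (z (Fin.last n))), ?_, ?_, ?_, ?_, ?_⟩
    · intro i
      induction i using Fin.lastCases with
      | last => rw [Fin.snoc_last]; exact hZ
      | cast i => rw [Fin.snoc_castSucc]; exact h₁ i
    · intro i k hik
      induction k using Fin.lastCases with
      | last =>
        rw [Fin.snoc_last]
        induction i using Fin.lastCases with
        | last => rw [Fin.snoc_last]; exact ⟨𝟙 _⟩
        | cast i => rw [Fin.snoc_castSucc]; exact hlow z hz i
      | cast k =>
        induction i using Fin.lastCases with
        | last => exact absurd (hik.trans_lt (Fin.castSucc_lt_last k)) (lt_irrefl _)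
        | cast i => rw [Fin.snoc_castSucc, Fin.snoc_castSucc]; exact h₂ i k (by simpa using hik)
    · intro T x hx
      have hxZ := @hx (Fin.last n)
      rw [Fin.snoc_last] at hxZ
      obtain ⟨y, rfl⟩ := hD' x hxZ
      refine h₃ y fun i T' s u hu => ?_
      have hxi := @hx i.castSucc
      rw [Fin.snoc_castSucc] at hxi
      exact hxi s u (by rw [reassoc_of% hu]; rfl)
    · intro i k hik T
      induction k using Fin.lastCases with
      | last =>
        rw [Fin.snoc_last]
        induction i using Fin.lastCases with
        | last => exact absurd hik (lt_irrefl _)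
        | cast i =>
          rw [Fin.snoc_castSucc]
          intro y w
          change T ⟶ (W i).left at y
          change T ⟶ Z at w
          change X.rel.Lt (y ≫ ((W i).hom ≫ d) ≫ j) (w ≫ z (Fin.last n) ≫ j)
          refine OrdObj.lt_of_not_le hC (fun {T'} s hs => ?_) (fun {T'} s hs => ?_)
          · refine isInitial_of_inl_eq_inr hc (s ≫ w) (s ≫ y ≫ (W i).hom) ?_
            rw [← cancel_mono j]
            simpa using hs.symm
          · refine h (Fin.snoc (α := fun _ => T' ⟶ D) (fun k => (s ≫ w) ≫ z k)
              (s ≫ y ≫ (W i).hom ≫ d)) ?_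
            exact (hz.precomp (s ≫ w)).snoc X.transitive (by simpa using hs)
      | cast k =>
        induction i using Fin.lastCases with
        | last => exact absurd (hik.trans (Fin.castSucc_lt_last k)) (lt_irrefl _)
        | cast i =>
          rw [Fin.snoc_castSucc, Fin.snoc_castSucc]
          intro y w
          have := h₄ i k (by simpa using hik) y w
          rw [← Category.assoc (W i).hom, ← Category.assoc (W k).hom] at this
          exact this
    · intro T c hcc i
      induction i using Fin.lastCases with
      | last =>
        rw [Fin.snoc_last]
        obtain ⟨t, -⟩ := hz' c hcc
        exact ⟨t⟩
      | cast i => rw [Fin.snoc_castSucc]; exact hlow c hcc i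

/-- A chain in a lexicographic sum of fewer subobjects of the final object than it has elements
lives over the initial object. -/
theorem IsLexSum.isInitial_of_increasing {X : OrdObj C} {n : ℕ} {Y : Fin n → Subobject (⊤_ C)}
    {inc : ∀ i, (subterminalOrd (Y i)).obj ⟶ X.obj}
    (hX : IsLexSum X (fun i => subterminalOrd (Y i)) inc) {T : C} (c : Fin (n + 1) → (T ⟶ X.obj))
    (hc : X.rel.Increasing c) : Nonempty (IsInitial T) := by
  obtain ⟨⟨hcol⟩, hlt⟩ := hX
  -- the element number `k` of the chain cannot be in a summand with a smaller index
  have key : ∀ (k : ℕ) (hk : k < n + 1) (i : Fin n), i.val < k → ∀ {T' : C} (s : T' ⟶ T)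
      (u : T' ⟶ (subterminalOrd (Y i)).obj), s ≫ c ⟨k, hk⟩ = u ≫ inc i →
      Nonempty (IsInitial T') := by
    intro k
    induction k with
    | zero => intro _ _ h; omega
    | succ k ih =>
      intro hk i hi T' s u hu
      refine isInitial_of_cover hcol (s ≫ c ⟨k, by omega⟩) fun l T₁ s₁ v hv => ?_
      obtain ⟨l⟩ := l
      change T₁ ⟶ (subterminalOrd (Y l)).obj at v
      replace hv : s₁ ≫ s ≫ c ⟨k, by omega⟩ = v ≫ inc l := hv
      by_cases hl : l.val < k
      · exact ih _ l hl (s₁ ≫ s) v (by simpa using hv)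
      obtain ⟨e₁, e₂⟩ := (hlt _ _).1 (hc ⟨k, by omega⟩ ⟨k + 1, hk⟩ (Fin.lt_def.2 (by simp)))
      have hu' : (s₁ ≫ s) ≫ c ⟨k + 1, hk⟩ = (s₁ ≫ u) ≫ inc i := by simp [hu]
      rcases (show i ≤ l from Fin.le_def.2 (by omega)).eq_or_lt with rfl | hil
      · obtain ⟨t, -⟩ := e₁ i _ (s₁ ≫ s) v (s₁ ≫ u) (by simpa using hv) hu'
        exact isInitial_of_hom initialIsInitial t
      · exact e₂ l i hil _ (s₁ ≫ s) v (s₁ ≫ u) (by simpa using hv) hu'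
  refine isInitial_of_cover hcol (c (Fin.last n)) fun l T₁ s v hv => ?_
  exact key n (by omega) l.as l.as.2 s v hv

/-- An ordered object of a lextensive category with complements has no chains of length `n + 1` if
and only if it is a lexicographic sum of a decreasing sequence of `n` subobjects of the final
object. -/
theorem OrdObj.powerIsZero_iff_exists_isLexSum (hC : HasComplements C) (X : OrdObj C) (n : ℕ) :
    X.PowerIsZero (n + 1) ↔
      ∃ Y : Fin n → Subobject (⊤_ C), Antitone Y ∧
        ∃ inc : ∀ i, (subterminalOrd (Y i)).obj ⟶ X.obj,
          IsLexSum X (fun i => subterminalOrd (Y i)) inc := by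
  constructor
  · rintro ⟨E, x, hE, ⟨hI⟩⟩
    obtain ⟨W, h₁, h₂, h₃, h₄, -⟩ := X.exists_decomposition hC n (𝟙 X.obj) fun c hc => by
      obtain ⟨t, -⟩ := (hE.existsUnique_lift c (by simpa [BinRel.Increasing] using hc)).exists
      exact isInitial_of_hom hI t
    have hm : ∀ i, Mono (terminal.from (W i).left) := fun i => ⟨fun f g _ => h₁ i f g⟩
    let Y : Fin n → Subobject (⊤_ C) := fun i => Subobject.mk (terminal.from (W i).left)
    let e : ∀ i, (Y i : C) ≅ (W i).left := fun i =>
      Subobject.underlyingIso (terminal.from (W i).left)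
    have hY : ∀ i, IsSubterminal (Y i : C) := fun i T f g =>
      (cancel_mono (e i).hom).1 (h₁ i _ _)
    have hinc : ∀ i, Mono ((e i).hom ≫ (W i).hom) := fun i => ⟨fun f g _ => hY i f g⟩
    have hlt : ∀ i k, i < k → ∀ {T : C} (y : T ⟶ (Y i : C)) (z : T ⟶ (Y k : C)),
        X.rel.Lt (y ≫ (e i).hom ≫ (W i).hom) (z ≫ (e k).hom ≫ (W k).hom) := fun i k hik T y z => by
      simpa using h₄ i k hik (y ≫ (e i).hom) (z ≫ (e k).hom)
    have hcol : Nonempty (IsColimit (Cofan.mk X.obj fun i => (e i).hom ≫ (W i).hom)) := by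
      refine hC.isColimit_of_disjoint _ ?_ ?_
      · intro i k hik T a b hab
        rcases lt_or_gt_of_ne hik with hik | hik
        · have := hlt i k hik a b
          rw [hab] at this
          exact X.isInitial_of_lt_self this
        · have := hlt k i hik b a
          rw [hab] at this
          exact X.isInitial_of_lt_self this
      · intro T x hx
        exact h₃ x fun i T' s u hu => hx i s (u ≫ (e i).inv) (by simpa using hu)
    refine ⟨Y, fun i k hik => ?_, fun i => (e i).hom ≫ (W i).hom, hcol, ?_⟩
    · obtain ⟨t⟩ := h₂ i k hik
      exact Subobject.mk_le_mk_of_comm t (Subsingleton.elim _ _)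
    intro T a b
    constructor
    · intro hab
      refine ⟨fun i T' t a' b' ha hb => ?_, fun i k hik T' t a' b' ha hb => ?_⟩
      · obtain rfl : a' = b' := hY i a' b'
        have := hab.precomp t
        rw [ha, hb] at this
        exact BinRel.lt_of_isInitial _ (X.isInitial_of_lt_self this).some _ _
      · have := hab.precomp t
        rw [ha, hb] at this
        exact X.isInitial_of_lt_of_lt this (hlt k i hik b' a')
    · rintro ⟨e₁, e₂⟩
      -- on a piece where `a` and `b` are in given summands, `b ≤ a` contradicts `LexLt`
      have key : ∀ {T' : C} (s : T' ⟶ T), (s ≫ a = s ≫ b ∨ X.rel.Lt (s ≫ b) (s ≫ a)) →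
          Nonempty (IsInitial T') := by
        intro T' s hs
        refine isInitial_of_cover hcol.some (s ≫ a) fun i T₁ s₁ u hu => ?_
        refine isInitial_of_cover hcol.some ((s₁ ≫ s) ≫ b) fun k T₂ s₂ v hv => ?_
        obtain ⟨i⟩ := i
        obtain ⟨k⟩ := k
        replace hu : (s₂ ≫ s₁ ≫ s) ≫ a = (s₂ ≫ u) ≫ (e i).hom ≫ (W i).hom := by
          simpa using s₂ ≫= hu
        replace hv : (s₂ ≫ s₁ ≫ s) ≫ b = v ≫ (e k).hom ≫ (W k).hom := by
          simpa using hv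
        rcases lt_trichotomy i k with hik | rfl | hik
        · have h₅ := hlt i k hik (s₂ ≫ u) v
          rw [← hu, ← hv] at h₅
          rcases hs with hs | hs
          · have hs' := (s₂ ≫ s₁) ≫= hs
            simp only [Category.assoc] at hs' h₅
            rw [hs'] at h₅
            exact X.isInitial_of_lt_self h₅
          · exact X.isInitial_of_lt_of_lt h₅ (by simpa using hs.precomp (s₂ ≫ s₁))
        · obtain ⟨t, -⟩ := e₁ i _ _ (s₂ ≫ u) v hu hv
          exact isInitial_of_hom initialIsInitial t
        · exact e₂ i k hik _ _ (s₂ ≫ u) v hu hv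
      exact OrdObj.lt_of_not_le hC (fun s hs => key s (Or.inl hs)) (fun s hs => key s (Or.inr hs))
  · rintro ⟨Y, -, inc, hX⟩
    refine ⟨⊥_ C, fun _ => initial.to _, ⟨fun i j _ => ?_, fun {T} a ha => ?_⟩,
      ⟨initialIsInitial⟩⟩
    · exact BinRel.lt_of_isInitial _ initialIsInitial _ _
    · obtain ⟨hT⟩ := hX.isInitial_of_increasing a ha
      exact ⟨hT.to _, fun i => hT.hom_ext _ _, fun t _ => hT.hom_ext _ _⟩

end Decomposition

/-! ### Étale algebras as special Frobenius algebras -/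

section Frobenius

variable {𝔗 : Type u} [Category.{v} 𝔗] [MonoidalCategory 𝔗]

/-- A point of a self-dual object is determined by its pairing with all elements. -/
theorem eq_of_pairing_eq {X : 𝔗} (p : ExactPairing X X) {f g : 𝟙_ 𝔗 ⟶ X}
    (h : X ◁ f ≫ p.evaluation' = X ◁ g ≫ p.evaluation') : f = g := by
  have key : ∀ f : 𝟙_ 𝔗 ⟶ X, (λ_ (𝟙_ 𝔗)).inv ≫ p.coevaluation' ▷ 𝟙_ 𝔗 ≫ (α_ X X (𝟙_ 𝔗)).hom ≫
      X ◁ (X ◁ f ≫ p.evaluation') ≫ (ρ_ X).hom = f := by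
    intro f
    rw [MonoidalCategory.whiskerLeft_comp, Category.assoc, ← associator_naturality_right_assoc,
      ← whisker_exchange_assoc, reassoc_of% p.evaluation_coevaluation']
    simp
  rw [← key f, h, key g]

/-- Transport of the first zigzag identity along a pair of maps that are adjoint for the
pairings. -/
theorem zigzag_transport {A P : 𝔗} (p : ExactPairing A A) (E : P ⊗ P ⟶ 𝟙_ 𝔗) (f : A ⟶ P)
    (g : P ⟶ A) (h : P ◁ f ≫ E = g ▷ A ≫ p.evaluation') :
    P ◁ (p.coevaluation' ≫ (f ⊗ₘ f)) ≫ (α_ P P P).inv ≫ E ▷ P =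
      (ρ_ P).hom ≫ g ≫ f ≫ (λ_ P).inv := by
  have e : P ◁ (f ⊗ₘ f) ≫ (α_ P P P).inv ≫ E ▷ P =
      g ▷ (A ⊗ A) ≫ (α_ A A A).inv ≫ p.evaluation' ▷ A ≫ 𝟙_ 𝔗 ◁ f := by
    rw [MonoidalCategory.tensorHom_def, MonoidalCategory.whiskerLeft_comp, Category.assoc,
      associator_inv_naturality_right_assoc, whisker_exchange,
      associator_inv_naturality_middle_assoc, ← comp_whiskerRight_assoc, h, comp_whiskerRight_assoc,
      associator_inv_naturality_left_assoc]
  rw [MonoidalCategory.whiskerLeft_comp, Category.assoc, e, whisker_exchange_assoc,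
    reassoc_of% p.coevaluation_evaluation']
  simp

/-- Transport of the second zigzag identity along a pair of maps that are adjoint for the
pairings. -/
theorem zigzag_transport' {A P : 𝔗} (p : ExactPairing A A) (E : P ⊗ P ⟶ 𝟙_ 𝔗) (f : A ⟶ P)
    (g : P ⟶ A) (h : f ▷ P ≫ E = A ◁ g ≫ p.evaluation') :
    (p.coevaluation' ≫ (f ⊗ₘ f)) ▷ P ≫ (α_ P P P).hom ≫ P ◁ E =
      (λ_ P).hom ≫ g ≫ f ≫ (ρ_ P).inv := by
  have e : (f ⊗ₘ f) ▷ P ≫ (α_ P P P).hom ≫ P ◁ E =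
      (A ⊗ A) ◁ g ≫ (α_ A A A).hom ≫ A ◁ p.evaluation' ≫ f ▷ 𝟙_ 𝔗 := by
    rw [MonoidalCategory.tensorHom_def', comp_whiskerRight, Category.assoc,
      associator_naturality_left_assoc, ← whisker_exchange,
      associator_naturality_middle_assoc, ← MonoidalCategory.whiskerLeft_comp_assoc, h,
      MonoidalCategory.whiskerLeft_comp_assoc, associator_naturality_right_assoc]
  rw [comp_whiskerRight, Category.assoc, e, ← whisker_exchange_assoc,
    reassoc_of% p.evaluation_coevaluation']
  simp

/-- Monoidal functors preserve exact pairings. -/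
@[reducible]
def exactPairingMap {D : Type u'} [Category.{v'} D] [MonoidalCategory D] (F : 𝔗 ⥤ D) [F.Monoidal]
    {X Y : 𝔗} (p : ExactPairing X Y) : ExactPairing (F.obj X) (F.obj Y) where
  coevaluation' := Functor.LaxMonoidal.ε F ≫ F.map p.coevaluation' ≫ Functor.OplaxMonoidal.δ F X Y
  evaluation' := Functor.LaxMonoidal.μ F Y X ≫ F.map p.evaluation' ≫ Functor.OplaxMonoidal.η F
  coevaluation_evaluation' := by
    have h := congrArg F.map p.coevaluation_evaluation'
    simp only [Functor.map_comp, Functor.Monoidal.map_whiskerLeft,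
      Functor.Monoidal.map_whiskerRight, Functor.Monoidal.map_associator_inv,
      Functor.Monoidal.map_rightUnitor, Functor.Monoidal.map_leftUnitor_inv, Category.assoc,
      Functor.Monoidal.μ_δ_assoc] at h
    rw [← cancel_epi (Functor.OplaxMonoidal.δ F Y (𝟙_ 𝔗) ≫ F.obj Y ◁ Functor.OplaxMonoidal.η F),
      ← cancel_mono (Functor.LaxMonoidal.ε F ▷ F.obj Y ≫ Functor.LaxMonoidal.μ F (𝟙_ 𝔗) Y)]
    simpa using h
  evaluation_coevaluation' := by
    have h := congrArg F.map p.evaluation_coevaluation'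
    simp only [Functor.map_comp, Functor.Monoidal.map_whiskerLeft,
      Functor.Monoidal.map_whiskerRight, Functor.Monoidal.map_associator,
      Functor.Monoidal.map_leftUnitor, Functor.Monoidal.map_rightUnitor_inv, Category.assoc,
      Functor.Monoidal.μ_δ_assoc] at h
    rw [← cancel_epi (Functor.OplaxMonoidal.δ F (𝟙_ 𝔗) X ≫ Functor.OplaxMonoidal.η F ▷ F.obj X),
      ← cancel_mono (F.obj X ◁ Functor.LaxMonoidal.ε F ≫ Functor.LaxMonoidal.μ F X (𝟙_ 𝔗))]
    simpa using h

section Commutative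

variable [SymmetricCategory 𝔗]

/-- The form `l` on the commutative algebra `A` is a special Frobenius form: the pairing
`(x, y) ↦ l (x y)` is perfect, and its copairing multiplies to `1`. Then `l` is the trace. -/
def IsSpecialForm (A : 𝔗) [MonObj A] (l : A ⟶ 𝟙_ 𝔗) : Prop :=
  ∃ p : ExactPairing A A, p.evaluation' = μ[A] ≫ l ∧ p.coevaluation' ≫ μ[A] = η[A]

/-- The trace of an algebra, computed from a self-duality of its underlying object, for
any choice of the dual object in the definition of the trace. -/
theorem traceMap_eq (A : CommMon 𝔗) (D : 𝔗) [ExactPairing A.X D] (p : ExactPairing A.X A.X)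
    {l : A.X ⟶ 𝟙_ 𝔗} (hp : p.evaluation' = μ[A.X] ≫ l) :
    traceMap A D = (ρ_ A.X).inv ≫ A.X ◁ (p.coevaluation' ≫ μ[A.X]) ≫ μ[A.X] ≫ l := by
  -- duals are unique, so `D` is identified with `A.X`
  obtain ⟨φ, h₁, h₂⟩ : ∃ φ : A.X ⟶ D, η_ A.X D = p.coevaluation' ≫ A.X ◁ φ ∧
      φ ▷ A.X ≫ ε_ A.X D = p.evaluation' := by
    let i₁ : HasRightDual A.X := ⟨A.X⟩
    let i₂ : HasRightDual A.X := ⟨D⟩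
    refine ⟨@rightAdjointMate _ _ _ A.X A.X i₂ i₁ (𝟙 A.X), ?_, ?_⟩
    · have := @coevaluation_comp_rightAdjointMate _ _ _ A.X A.X i₂ i₁ (𝟙 A.X)
      rw [id_whiskerRight, Category.comp_id] at this
      exact this.symm
    · have := @rightAdjointMate_comp_evaluation _ _ _ A.X A.X i₂ i₁ (𝟙 A.X)
      rw [MonoidalCategory.whiskerLeft_id, Category.id_comp] at this
      exact this
  have h₃ : μ[A.X] ▷ A.X ≫ (β_ A.X A.X).hom ≫ μ[A.X] =
      (α_ A.X A.X A.X).hom ≫ A.X ◁ μ[A.X] ≫ μ[A.X] := by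
    rw [IsCommMonObj.mul_comm, MonObj.mul_assoc]
  rw [traceMap, h₁, MonoidalCategory.whiskerLeft_comp, Category.assoc,
    associator_inv_naturality_right_assoc, whisker_exchange_assoc,
    BraidedCategory.braiding_naturality_right_assoc, h₂, hp, reassoc_of% h₃,
    Iso.inv_hom_id_assoc, MonoidalCategory.whiskerLeft_comp, Category.assoc]

theorem IsSpecialForm.traceMap_eq {A : CommMon 𝔗} {l : A.X ⟶ 𝟙_ 𝔗} (h : IsSpecialForm A.X l) (D : 𝔗)
    [ExactPairing A.X D] : traceMap A D = l := by
  obtain ⟨p, hp, hp'⟩ := h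
  rw [OrderedEtale.traceMap_eq A D p hp, hp', MonObj.mul_one_assoc, Iso.inv_hom_id_assoc]

theorem IsSpecialForm.isEtale {A : CommMon 𝔗} {l : A.X ⟶ 𝟙_ 𝔗} (h : IsSpecialForm A.X l) :
    IsEtale A := by
  obtain ⟨p, hp, hp'⟩ := id h
  exact ⟨A.X, p, p, by rw [h.traceMap_eq, hp]⟩

/-- The copairing of the trace form of an étale algebra multiplies to `1`, because both sides
represent the trace. -/
theorem coevaluation_comp_mul {A : CommMon 𝔗} {D : 𝔗} [ExactPairing A.X D]
    {p : ExactPairing A.X A.X} (hp : p.evaluation' = μ[A.X] ≫ traceMap A D) :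
    p.coevaluation' ≫ μ[A.X] = η[A.X] := by
  refine eq_of_pairing_eq p ?_
  rw [hp, MonObj.mul_one_assoc, ← cancel_epi (ρ_ A.X).inv, Iso.inv_hom_id_assoc]
  exact (traceMap_eq A D p hp).symm

theorem IsSpecialForm.unique {A : CommMon 𝔗} {l l' : A.X ⟶ 𝟙_ 𝔗} (h : IsSpecialForm A.X l)
    (h' : IsSpecialForm A.X l') : l = l' := by
  obtain ⟨p, -⟩ := id h
  exact (h.traceMap_eq A.X).symm.trans (h'.traceMap_eq A.X)

/-- The map `s : C ⟶ B` is a section of the map `q : B ⟶ C` of algebras that is linear over `B`; so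
`C` is a direct factor of the algebra `B`. -/
structure IsFactor {B C : 𝔗} [MonObj B] [MonObj C] (q : B ⟶ C) (s : C ⟶ B) : Prop where
  section_comp : s ≫ q = 𝟙 C
  linear : B ◁ s ≫ μ[B] = q ▷ C ≫ μ[C] ≫ s

namespace IsFactor

variable {B C : 𝔗} [MonObj B] [MonObj C] [IsCommMonObj B] [IsCommMonObj C] {q : B ⟶ C} {s : C ⟶ B}

theorem linear' (h : IsFactor q s) : s ▷ B ≫ μ[B] = C ◁ q ≫ μ[C] ≫ s := by
  have := (β_ C B).hom ≫= h.linear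
  rwa [← BraidedCategory.braiding_naturality_left_assoc, IsCommMonObj.mul_comm,
    ← BraidedCategory.braiding_naturality_right_assoc, IsCommMonObj.mul_comm_assoc] at this

/-- A direct factor of an étale algebra is étale, and its trace is the restriction of the trace. -/
theorem isSpecialForm [IsMonHom q] (h : IsFactor q s) {l : B ⟶ 𝟙_ 𝔗} (hl : IsSpecialForm B l) :
    IsSpecialForm C (s ≫ l) := by
  obtain ⟨p, hp, hp'⟩ := hl
  refine ⟨⟨p.coevaluation' ≫ (q ⊗ₘ q), μ[C] ≫ s ≫ l, ?_, ?_⟩, rfl, ?_⟩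
  · rw [zigzag_transport p _ q s, reassoc_of% h.section_comp]
    rw [hp, reassoc_of% h.linear']
  · rw [zigzag_transport' p _ q s, reassoc_of% h.section_comp]
    rw [hp, reassoc_of% h.linear]
  · change (p.coevaluation' ≫ (q ⊗ₘ q)) ≫ μ[C] = η[C]
    rw [Category.assoc, ← IsMonHom.mul_hom, reassoc_of% hp', IsMonHom.one_hom]

end IsFactor

/-! ### Products and tensor products of étale algebras -/

/-- The product of two special Frobenius algebras is one. -/
theorem IsSpecialForm.prod [Preadditive 𝔗] [MonoidalPreadditive 𝔗] {P B C : 𝔗} [MonObj P]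
    [IsCommMonObj P] [MonObj B] [IsCommMonObj B] [MonObj C] [IsCommMonObj C]
    {q₁ : P ⟶ B} {s₁ : B ⟶ P} {q₂ : P ⟶ C} {s₂ : C ⟶ P} [IsMonHom q₁] [IsMonHom q₂]
    (h₁ : IsFactor q₁ s₁) (h₂ : IsFactor q₂ s₂) (h : q₁ ≫ s₁ + q₂ ≫ s₂ = 𝟙 P)
    {l₁ : B ⟶ 𝟙_ 𝔗} {l₂ : C ⟶ 𝟙_ 𝔗} (hl₁ : IsSpecialForm B l₁) (hl₂ : IsSpecialForm C l₂)
    (h₁₂ : s₁ ≫ q₂ = 0) (h₂₁ : s₂ ≫ q₁ = 0) :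
    IsSpecialForm P (q₁ ≫ l₁ + q₂ ≫ l₂) := by
  obtain ⟨p₁, hp₁, hp₁'⟩ := hl₁
  obtain ⟨p₂, hp₂, hp₂'⟩ := hl₂
  have e₁ : s₁ ≫ (q₁ ≫ l₁ + q₂ ≫ l₂) = l₁ := by
    rw [Preadditive.comp_add, reassoc_of% h₁.section_comp, reassoc_of% h₁₂, zero_comp, add_zero]
  have e₂ : s₂ ≫ (q₁ ≫ l₁ + q₂ ≫ l₂) = l₂ := by
    rw [Preadditive.comp_add, reassoc_of% h₂.section_comp, reassoc_of% h₂₁, zero_comp, zero_add]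
  refine ⟨⟨p₁.coevaluation' ≫ (s₁ ⊗ₘ s₁) + p₂.coevaluation' ≫ (s₂ ⊗ₘ s₂),
    μ[P] ≫ (q₁ ≫ l₁ + q₂ ≫ l₂), ?_, ?_⟩, rfl, ?_⟩
  · rw [MonoidalPreadditive.whiskerLeft_add, Preadditive.add_comp,
      zigzag_transport p₁ _ s₁ q₁ (by rw [reassoc_of% h₁.linear, e₁, hp₁]),
      zigzag_transport p₂ _ s₂ q₂ (by rw [reassoc_of% h₂.linear, e₂, hp₂]),
      ← Preadditive.comp_add, ← Category.assoc q₁, ← Category.assoc q₂, ← Preadditive.add_comp, h,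
      Category.id_comp]
  · rw [MonoidalPreadditive.add_whiskerRight, Preadditive.add_comp,
      zigzag_transport' p₁ _ s₁ q₁ (by rw [reassoc_of% h₁.linear', e₁, hp₁]),
      zigzag_transport' p₂ _ s₂ q₂ (by rw [reassoc_of% h₂.linear', e₂, hp₂]),
      ← Preadditive.comp_add, ← Category.assoc q₁, ← Category.assoc q₂, ← Preadditive.add_comp, h,
      Category.id_comp]
  · have m₁ : (s₁ ⊗ₘ s₁) ≫ μ[P] = μ[B] ≫ s₁ := by
      rw [MonoidalCategory.tensorHom_def, Category.assoc, h₁.linear, ← comp_whiskerRight_assoc,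
        h₁.section_comp, id_whiskerRight, Category.id_comp]
    have m₂ : (s₂ ⊗ₘ s₂) ≫ μ[P] = μ[C] ≫ s₂ := by
      rw [MonoidalCategory.tensorHom_def, Category.assoc, h₂.linear, ← comp_whiskerRight_assoc,
        h₂.section_comp, id_whiskerRight, Category.id_comp]
    change (p₁.coevaluation' ≫ (s₁ ⊗ₘ s₁) + p₂.coevaluation' ≫ (s₂ ⊗ₘ s₂)) ≫ μ[P] = η[P]
    rw [Preadditive.add_comp, Category.assoc, Category.assoc, m₁, m₂, reassoc_of% hp₁',
      reassoc_of% hp₂', ← IsMonHom.one_hom q₁, ← IsMonHom.one_hom q₂, Category.assoc,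
      Category.assoc, ← Preadditive.comp_add, h, Category.comp_id]

/-- The tensor product of two special Frobenius algebras is one. -/
theorem IsSpecialForm.tensor {A B : 𝔗} [MonObj A] [MonObj B] {l : A ⟶ 𝟙_ 𝔗} {l' : B ⟶ 𝟙_ 𝔗}
    (h : IsSpecialForm A l) (h' : IsSpecialForm B l') :
    IsSpecialForm (A ⊗ B) ((l ⊗ₘ l') ≫ (λ_ (𝟙_ 𝔗)).hom) := by
  obtain ⟨p, hp, hq⟩ := h
  obtain ⟨p', hp', hq'⟩ := h'
  -- the tensor product is a monoidal functor of two variables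
  let pp : ExactPairing ((A, B) : 𝔗 × 𝔗) ((A, B) : 𝔗 × 𝔗) :=
    { coevaluation' := ⟨p.coevaluation', p'.coevaluation'⟩
      evaluation' := ⟨p.evaluation', p'.evaluation'⟩
      coevaluation_evaluation' :=
        Prod.ext p.coevaluation_evaluation' p'.coevaluation_evaluation'
      evaluation_coevaluation' :=
        Prod.ext p.evaluation_coevaluation' p'.evaluation_coevaluation' }
  refine ⟨exactPairingMap (MonoidalCategory.tensor 𝔗) pp, ?_, ?_⟩
  · change tensorμ A B A B ≫ (p.evaluation' ⊗ₘ p'.evaluation') ≫ (λ_ (𝟙_ 𝔗)).hom = _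
    rw [hp, hp', tensorObj.mul_def, ← tensorHom_comp_tensorHom]
    simp only [Category.assoc]
  · change ((λ_ (𝟙_ 𝔗)).inv ≫ (p.coevaluation' ⊗ₘ p'.coevaluation') ≫ tensorδ A B A B) ≫ _ = _
    rw [tensorObj.mul_def, tensorObj.one_def, Category.assoc, Category.assoc,
      tensorδ_tensorμ_assoc, tensorHom_comp_tensorHom, hq, hq']

end Commutative

end Frobenius

/-! ### The category of étale algebras -/

section EtaleAlgebras

variable {𝔗 : Type u} [Category.{v} 𝔗] [MonoidalCategory 𝔗]

theorem isMonHom_one (X : 𝔗) [MonObj X] : IsMonHom η[X] where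
  one_hom := Category.id_comp _
  mul_hom := by
    change (λ_ (𝟙_ 𝔗)).hom ≫ η[X] = (η[X] ⊗ₘ η[X]) ≫ μ[X]
    rw [MonoidalCategory.tensorHom_def', Category.assoc, MonObj.one_mul, leftUnitor_naturality]

variable [SymmetricCategory 𝔗]

namespace Et

/-- The trace map of an étale algebra. -/
noncomputable def trace (A : Et 𝔗) : A.X ⟶ 𝟙_ 𝔗 :=
  letI := A.property.choose_spec.choose
  traceMap A.obj A.property.choose

theorem selfDual_evaluation (A : Et 𝔗) : A.selfDual.evaluation' = μ[A.X] ≫ A.trace :=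
  A.property.choose_spec.choose_spec.choose_spec

theorem isSpecialForm_trace (A : Et 𝔗) : IsSpecialForm A.X A.trace :=
  letI := A.property.choose_spec.choose
  ⟨A.selfDual, A.selfDual_evaluation, coevaluation_comp_mul A.selfDual_evaluation⟩

/-- The étale algebra defined by an algebra with a special Frobenius form. -/
noncomputable abbrev ofForm (X : 𝔗) [MonObj X] [IsCommMonObj X] {l : X ⟶ 𝟙_ 𝔗}
    (h : IsSpecialForm X l) : Et 𝔗 :=
  ⟨CommMon.mk X, IsSpecialForm.isEtale (A := CommMon.mk X) h⟩

theorem trace_eq {A : Et 𝔗} {l : A.X ⟶ 𝟙_ 𝔗} (h : IsSpecialForm A.X l) : A.trace = l :=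
  A.isSpecialForm_trace.unique h

instance isMonHom_map {A B : Et 𝔗} (f : A ⟶ B) : IsMonHom (map f) :=
  f.hom.hom.isMonHom_hom

/-- The homomorphism of étale algebras with a given underlying map. -/
def ofMap {A B : Et 𝔗} (f : A.X ⟶ B.X) (h : IsMonHom f) : A ⟶ B :=
  ObjectProperty.homMk (CommMon.homMk { hom := f, isMonHom_hom := h })

theorem map_ofMap {A B : Et 𝔗} (f : A.X ⟶ B.X) (h : IsMonHom f) : map (ofMap f h) = f :=
  rfl

theorem map_comp {A B C : Et 𝔗} (f : A ⟶ B) (g : B ⟶ C) : map (f ≫ g) = map f ≫ map g :=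
  rfl

theorem map_id (A : Et 𝔗) : map (𝟙 A) = 𝟙 A.X :=
  rfl

theorem hom_ext {A B : Et 𝔗} {f g : A ⟶ B} (h : map f = map g) : f = g :=
  ObjectProperty.hom_ext _ (CommMon.hom_ext _ _ h)

theorem one_map {A B : Et 𝔗} (f : A ⟶ B) : η[A.X] ≫ map f = η[B.X] :=
  IsMonHom.one_hom (map f)

theorem mul_map {A B : Et 𝔗} (f : A ⟶ B) : μ[A.X] ≫ map f = (map f ⊗ₘ map f) ≫ μ[B.X] :=
  IsMonHom.mul_hom (map f)

/-- The invariant `f^∨(1)` represents the linear form `x ↦ trace (f x)`. -/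
theorem gammaTilde_pairing {A B : Et 𝔗} (f : A ⟶ B) :
    A.X ◁ gammaTilde f ≫ μ[A.X] ≫ A.trace = (ρ_ A.X).hom ≫ map f ≫ B.trace := by
  have h₁ : gammaTilde f =
      A.selfDual.coevaluation' ≫ (map f ≫ B.trace) ▷ A.X ≫ (λ_ A.X).hom := by
    rw [gammaTilde, dualMap, selfDual_evaluation, rightUnitor_inv_naturality_assoc,
      ← whisker_exchange_assoc, associator_inv_naturality_left_assoc, ← comp_whiskerRight_assoc,
      MonObj.one_mul_assoc]
    monoidal
  have h₂ : gammaTilde f ▷ A.X ≫ μ[A.X] ≫ A.trace = (λ_ A.X).hom ≫ map f ≫ B.trace := by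
    have h := A.selfDual.evaluation_coevaluation' =≫ ((map f ≫ B.trace) ▷ 𝟙_ 𝔗 ≫ (λ_ _).hom)
    have h' : ∀ g : A.X ⟶ 𝟙_ 𝔗, (g ▷ A.X ≫ (λ_ A.X).hom) ▷ A.X ≫ A.selfDual.evaluation' =
        (α_ A.X A.X A.X).hom ≫ A.X ◁ A.selfDual.evaluation' ≫ g ▷ 𝟙_ 𝔗 ≫ (λ_ _).hom := by
      intro g
      rw [whisker_exchange_assoc, leftUnitor_naturality]
      simp
    rw [h₁, ← selfDual_evaluation, comp_whiskerRight, Category.assoc, h']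
    simp only [Category.assoc] at h
    rw [h]
    simp [unitors_equal]
  -- the trace pairing is symmetric
  rw [← IsCommMonObj.mul_comm_assoc, BraidedCategory.braiding_naturality_right_assoc, h₂]
  simp

/-- The invariant `f^∨(1)` is the only point that represents the linear form
`x ↦ trace (f x)`. -/
theorem eq_gammaTilde {A B : Et 𝔗} {f : A ⟶ B} {g : 𝟙_ 𝔗 ⟶ A.X}
    (h : A.X ◁ g ≫ μ[A.X] ≫ A.trace = (ρ_ A.X).hom ≫ map f ≫ B.trace) : g = gammaTilde f := by
  refine eq_of_pairing_eq A.selfDual ?_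
  rw [selfDual_evaluation, h, gammaTilde_pairing]

theorem gammaTilde_id (A : Et 𝔗) : gammaTilde (𝟙 A) = η[A.X] :=
  (eq_gammaTilde (by rw [MonObj.mul_one_assoc, map_id, Category.id_comp])).symm

theorem trace_one : (one 𝔗).trace = 𝟙 _ := by
  refine trace_eq ⟨exactPairingUnit, ?_, ?_⟩
  · change (ρ_ (𝟙_ 𝔗)).hom = (λ_ (𝟙_ 𝔗)).hom ≫ 𝟙 _
    rw [unitors_equal, Category.comp_id]
  · change (ρ_ (𝟙_ 𝔗)).inv ≫ (λ_ (𝟙_ 𝔗)).hom = 𝟙 _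
    rw [unitors_equal, Iso.inv_hom_id]

theorem isZero_of_one_eq_zero [Preadditive 𝔗] [MonoidalPreadditive 𝔗] {A : Et 𝔗}
    (h : η[A.X] = 0) : IsZero A.X := by
  rw [IsZero.iff_id_eq_zero, ← Iso.inv_hom_id (λ_ A.X), ← MonObj.one_mul A.X, h,
    MonoidalPreadditive.zero_whiskerRight, zero_comp, comp_zero]

/-! ### Coproducts of étale algebras -/

/-- The tensor product of two étale algebras, which is their coproduct. -/
noncomputable abbrev tensor (A B : Et 𝔗) : Et 𝔗 :=
  ofForm (A.X ⊗ B.X) (A.isSpecialForm_trace.tensor B.isSpecialForm_trace)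

theorem trace_tensor (A B : Et 𝔗) :
    (tensor A B).trace = (A.trace ⊗ₘ B.trace) ≫ (λ_ (𝟙_ 𝔗)).hom :=
  trace_eq (A := tensor A B) (A.isSpecialForm_trace.tensor B.isSpecialForm_trace)

theorem isMonHom_mul (X : 𝔗) [MonObj X] [IsCommMonObj X] : IsMonHom μ[X] where
  one_hom := by
    rw [tensorObj.one_def, Category.assoc]
    rw [MonoidalCategory.tensorHom_def', Category.assoc, MonObj.one_mul, leftUnitor_naturality,
      Iso.inv_hom_id_assoc]
  mul_hom := by
    rw [tensorObj.mul_def, Category.assoc]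
    exact mul_mul_mul_comm X

/-- The first inclusion in the tensor product. -/
noncomputable def inl (A B : Et 𝔗) : A ⟶ tensor A B :=
  ofMap ((ρ_ A.X).inv ≫ A.X ◁ η[B.X]) (by
    have := isMonHom_one B.X
    infer_instance)

/-- The second inclusion in the tensor product. -/
noncomputable def inr (A B : Et 𝔗) : B ⟶ tensor A B :=
  ofMap ((λ_ B.X).inv ≫ η[A.X] ▷ B.X) (by
    have := isMonHom_one A.X
    infer_instance)

/-- The map from the tensor product defined by two maps. -/
noncomputable def desc {A B C : Et 𝔗} (f : A ⟶ C) (g : B ⟶ C) : tensor A B ⟶ C :=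
  ofMap ((map f ⊗ₘ map g) ≫ μ[C.X]) (by
    have := isMonHom_mul C.X
    infer_instance)

theorem map_inl (A B : Et 𝔗) : map (inl A B) = (ρ_ A.X).inv ≫ A.X ◁ η[B.X] := rfl

theorem map_inr (A B : Et 𝔗) : map (inr A B) = (λ_ B.X).inv ≫ η[A.X] ▷ B.X := rfl

theorem map_desc {A B C : Et 𝔗} (f : A ⟶ C) (g : B ⟶ C) :
    map (desc f g) = (map f ⊗ₘ map g) ≫ μ[C.X] := rfl

theorem inl_desc {A B C : Et 𝔗} (f : A ⟶ C) (g : B ⟶ C) : inl A B ≫ desc f g = f := by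
  apply hom_ext
  rw [map_comp, map_inl, map_desc, MonoidalCategory.tensorHom_def', Category.assoc, Category.assoc,
    ← MonoidalCategory.whiskerLeft_comp_assoc, one_map, whisker_exchange_assoc, MonObj.mul_one]
  simp

theorem inr_desc {A B C : Et 𝔗} (f : A ⟶ C) (g : B ⟶ C) : inr A B ≫ desc f g = g := by
  apply hom_ext
  rw [map_comp, map_inr, map_desc, MonoidalCategory.tensorHom_def, Category.assoc, Category.assoc,
    ← comp_whiskerRight_assoc, one_map, ← whisker_exchange_assoc, MonObj.one_mul]
  simp

theorem inl_tensor_inr_mul (A B : Et 𝔗) :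
    (map (inl A B) ⊗ₘ map (inr A B)) ≫ μ[A.X ⊗ B.X] = 𝟙 _ := by
  have h : ((ρ_ A.X).inv ⊗ₘ (λ_ B.X).inv) ≫ tensorμ A.X (𝟙_ 𝔗) (𝟙_ 𝔗) B.X ≫
      ((ρ_ A.X).hom ⊗ₘ (λ_ B.X).hom) = 𝟙 _ := by
    rw [tensorμ, braiding_tensorUnit_left]
    monoidal
  rw [map_inl, map_inr, ← tensorHom_comp_tensorHom, tensorObj.mul_def, ← id_tensorHom,
    ← tensorHom_id, Category.assoc, tensorμ_natural_assoc, tensorHom_comp_tensorHom, id_tensorHom,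
    tensorHom_id, MonObj.mul_one, MonObj.one_mul, h]

theorem tensor_hom_ext {A B C : Et 𝔗} {f g : tensor A B ⟶ C} (h₁ : inl A B ≫ f = inl A B ≫ g)
    (h₂ : inr A B ≫ f = inr A B ≫ g) : f = g := by
  have key : ∀ f : tensor A B ⟶ C, map f = (map (inl A B ≫ f) ⊗ₘ map (inr A B ≫ f)) ≫ μ[C.X] := by
    intro f
    rw [map_comp, map_comp, ← tensorHom_comp_tensorHom, Category.assoc, ← mul_map, ← Category.assoc]
    rw [inl_tensor_inr_mul]
    exact (Category.id_comp _).symm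
  exact hom_ext (by rw [key f, key g, h₁, h₂])

end Et

end EtaleAlgebras

/-! ### Direct factors and products -/

section Factors

variable {𝔗 : Type u} [Category.{v} 𝔗] [MonoidalCategory 𝔗]

namespace IsFactor

section

variable {B C : 𝔗} [MonObj B] [MonObj C] {q : B ⟶ C} {s : C ⟶ B}

theorem tensorHom_mul (h : IsFactor q s) : (s ⊗ₘ s) ≫ μ[B] = μ[C] ≫ s := by
  rw [MonoidalCategory.tensorHom_def, Category.assoc, h.linear, ← comp_whiskerRight_assoc,
    h.section_comp, id_whiskerRight, Category.id_comp]

/-- The composition `q ≫ s` is the multiplication by the idempotent `s 1`. -/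
theorem comp_section (h : IsFactor q s) :
    q ≫ s = (ρ_ B).inv ≫ B ◁ (η[C] ≫ s) ≫ μ[B] := by
  rw [MonoidalCategory.whiskerLeft_comp, Category.assoc, h.linear, whisker_exchange_assoc,
    MonObj.mul_one_assoc, rightUnitor_naturality_assoc, Iso.inv_hom_id_assoc]

theorem comp {D : 𝔗} [MonObj D] {q' : C ⟶ D} {s' : D ⟶ C} (h : IsFactor q s)
    (h' : IsFactor q' s') : IsFactor (q ≫ q') (s' ≫ s) where
  section_comp := by rw [Category.assoc, reassoc_of% h.section_comp, h'.section_comp]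
  linear := by
    rw [MonoidalCategory.whiskerLeft_comp, Category.assoc, h.linear, whisker_exchange_assoc,
      reassoc_of% h'.linear, comp_whiskerRight_assoc]

end

end IsFactor

/-- A direct factor of an algebra is cut out by an idempotent; a homomorphism that sends this
idempotent to `1` factors through the direct factor. -/
theorem IsFactor.exists_lift [SymmetricCategory 𝔗] {B C Z : Et 𝔗} {q : B ⟶ C} {s : C.X ⟶ B.X}
    (h : IsFactor (Et.map q) s) (f : B ⟶ Z) (hf : η[C.X] ≫ s ≫ Et.map f = η[Z.X]) :
    ∃ t : C ⟶ Z, q ≫ t = f := by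
  refine ⟨Et.ofMap (s ≫ Et.map f) ⟨hf, ?_⟩, Et.hom_ext ?_⟩
  · rw [← reassoc_of% h.tensorHom_mul, Et.mul_map, tensorHom_comp_tensorHom_assoc]
  · rw [Et.map_comp, Et.map_ofMap, ← Category.assoc, h.comp_section, Category.assoc, Category.assoc,
      Et.mul_map, MonoidalCategory.tensorHom_def', Category.assoc,
      ← MonoidalCategory.whiskerLeft_comp_assoc, Category.assoc, hf, whisker_exchange_assoc,
      MonObj.mul_one, rightUnitor_naturality, Iso.inv_hom_id_assoc]

theorem comp_tensorHom_eq {X Y Z X' Y' : 𝔗} (f : X ⟶ Y) (g : Y ⟶ Z) (h : X' ⟶ Y') :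
    (f ≫ g) ⊗ₘ h = (f ⊗ₘ h) ≫ g ▷ Y' := by
  rw [MonoidalCategory.tensorHom_def', MonoidalCategory.tensorHom_def', comp_whiskerRight,
    Category.assoc]

theorem tensorHom_comp_eq {X Y Z X' Y' : 𝔗} (f : X ⟶ Y) (g : Y ⟶ Z) (h : X' ⟶ Y') :
    h ⊗ₘ (f ≫ g) = (h ⊗ₘ f) ≫ Y' ◁ g := by
  rw [MonoidalCategory.tensorHom_def, MonoidalCategory.tensorHom_def,
    MonoidalCategory.whiskerLeft_comp, Category.assoc]

/-- If `q ≫ s` is a splitting through `Y` of an idempotent endomorphism of an algebra `Z` that is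
linear over `Z` on both sides, then `Y` is an algebra. -/
@[reducible]
def retractMonObj {Z Y : 𝔗} [MonObj Z] (q : Z ⟶ Y) (s : Y ⟶ Z) (h : s ≫ q = 𝟙 Y)
    (h₁ : (q ≫ s) ▷ Z ≫ μ[Z] = μ[Z] ≫ q ≫ s) (h₂ : Z ◁ (q ≫ s) ≫ μ[Z] = μ[Z] ≫ q ≫ s) :
    MonObj Y :=
  have h₁' : (q ≫ s) ▷ Z ≫ μ[Z] ≫ q = μ[Z] ≫ q := by
    rw [reassoc_of% h₁, h, Category.comp_id]
  have h₂' : Z ◁ (q ≫ s) ≫ μ[Z] ≫ q = μ[Z] ≫ q := by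
    rw [reassoc_of% h₂, h, Category.comp_id]
  { one := η[Z] ≫ q
    mul := (s ⊗ₘ s) ≫ μ[Z] ≫ q
    one_mul := by
      rw [MonoidalCategory.tensorHom_def, Category.assoc, ← comp_whiskerRight_assoc, Category.assoc,
        ← whisker_exchange_assoc, comp_whiskerRight_assoc, h₁', MonObj.one_mul_assoc,
        leftUnitor_naturality_assoc, h, Category.comp_id]
    mul_one := by
      rw [MonoidalCategory.tensorHom_def', Category.assoc,
        ← MonoidalCategory.whiskerLeft_comp_assoc, Category.assoc,
        whisker_exchange_assoc, MonoidalCategory.whiskerLeft_comp_assoc, h₂',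
        MonObj.mul_one_assoc, rightUnitor_naturality_assoc, h, Category.comp_id]
    mul_assoc := by
      have e₁ : ((s ⊗ₘ s) ≫ μ[Z] ≫ q) ▷ Y ≫ (s ⊗ₘ s) ≫ μ[Z] ≫ q =
          ((s ⊗ₘ s) ⊗ₘ s) ≫ μ[Z] ▷ Z ≫ μ[Z] ≫ q := by
        rw [← tensorHom_id, tensorHom_comp_tensorHom_assoc, Category.id_comp, Category.assoc,
          Category.assoc, comp_tensorHom_eq, Category.assoc, comp_whiskerRight_assoc, h₁']
      have e₂ : Y ◁ ((s ⊗ₘ s) ≫ μ[Z] ≫ q) ≫ (s ⊗ₘ s) ≫ μ[Z] ≫ q =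
          (s ⊗ₘ s ⊗ₘ s) ≫ Z ◁ μ[Z] ≫ μ[Z] ≫ q := by
        rw [← id_tensorHom, tensorHom_comp_tensorHom_assoc, Category.id_comp, Category.assoc,
          Category.assoc, tensorHom_comp_eq, Category.assoc,
          MonoidalCategory.whiskerLeft_comp_assoc, h₂']
      rw [e₁, e₂, MonObj.mul_assoc_assoc, associator_naturality_assoc] }

/-- In an idempotent complete category every idempotent of an étale algebra cuts out a direct
factor. -/
theorem Et.exists_factor_of_idem [SymmetricCategory 𝔗] [IsIdempotentComplete 𝔗] (Z : Et 𝔗)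
    (e : 𝟙_ 𝔗 ⟶ Z.X) (he : (λ_ (𝟙_ 𝔗)).inv ≫ (e ⊗ₘ e) ≫ μ[Z.X] = e) :
    ∃ (S : Et 𝔗) (q : Z ⟶ S) (s : S.X ⟶ Z.X), IsFactor (Et.map q) s ∧ η[S.X] ≫ s = e := by
  -- the multiplication by `e`
  set E : Z.X ⟶ Z.X := (ρ_ Z.X).inv ≫ Z.X ◁ e ≫ μ[Z.X] with hE
  have h₂ : Z.X ◁ E ≫ μ[Z.X] = μ[Z.X] ≫ E := by
    rw [hE, MonoidalCategory.whiskerLeft_comp, MonoidalCategory.whiskerLeft_comp, Category.assoc,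
      Category.assoc, MonObj.mul_assoc_flip, associator_inv_naturality_right_assoc,
      whisker_exchange_assoc]
    simp
  have h₁ : E ▷ Z.X ≫ μ[Z.X] = μ[Z.X] ≫ E := by
    rw [← IsCommMonObj.mul_comm_assoc, ← h₂, ← BraidedCategory.braiding_naturality_left_assoc,
      IsCommMonObj.mul_comm]
  have heE : e ≫ E = e := by
    rw [hE, rightUnitor_inv_naturality_assoc, ← MonoidalCategory.tensorHom_def_assoc,
      ← unitors_inv_equal, he]
  have hEE : E ≫ E = E := by
    conv_lhs => rw [hE]
    rw [Category.assoc, Category.assoc, ← h₂, ← MonoidalCategory.whiskerLeft_comp_assoc, heE]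
  obtain ⟨Y, s, q, hsq, hqs⟩ := IsIdempotentComplete.idempotents_split Z.X E hEE
  rw [← hqs] at h₁ h₂
  let := retractMonObj q s hsq h₁ h₂
  have hμ : μ[Y] = (s ⊗ₘ s) ≫ μ[Z.X] ≫ q := rfl
  have hη : η[Y] = η[Z.X] ≫ q := rfl
  have : IsCommMonObj Y := ⟨by
    rw [hμ, ← BraidedCategory.braiding_naturality_assoc, IsCommMonObj.mul_comm_assoc]⟩
  have hq : IsMonHom q := by
    refine ⟨hη.symm, ?_⟩
    rw [hμ, tensorHom_comp_tensorHom_assoc, MonoidalCategory.tensorHom_def, Category.assoc,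
      reassoc_of% h₂, reassoc_of% h₁, hsq, Category.comp_id, hsq,
      Category.comp_id]
  have hf : IsFactor q s := by
    refine ⟨hsq, ?_⟩
    rw [hμ, MonoidalCategory.tensorHom_def, Category.assoc, Category.assoc, Category.assoc,
      ← comp_whiskerRight_assoc, ← whisker_exchange_assoc, reassoc_of% h₁, reassoc_of% hsq,
      ← h₂, ← MonoidalCategory.whiskerLeft_comp_assoc, reassoc_of% hsq]
  refine ⟨Et.ofForm Y (hf.isSpecialForm Z.isSpecialForm_trace), Et.ofMap q hq, s, hf, ?_⟩
  change η[Y] ≫ s = e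
  rw [hη, Category.assoc, hqs, hE, rightUnitor_inv_naturality_assoc, ← whisker_exchange_assoc,
    MonObj.one_mul]
  simp [unitors_equal]

/-- The axioms of an algebra hold for operations on `P` after composition with a map `p` to an
algebra that is compatible with the operations; so they hold if such maps are jointly monic. -/
theorem monObj_axioms_comp {P B : 𝔗} [MonObj B] (o : 𝟙_ 𝔗 ⟶ P) (m : P ⊗ P ⟶ P) (p : P ⟶ B)
    (ho : o ≫ p = η[B]) (hm : m ≫ p = (p ⊗ₘ p) ≫ μ[B]) :
    (o ▷ P ≫ m) ≫ p = (λ_ P).hom ≫ p ∧ (P ◁ o ≫ m) ≫ p = (ρ_ P).hom ≫ p ∧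
    (m ▷ P ≫ m) ≫ p = ((α_ P P P).hom ≫ P ◁ m ≫ m) ≫ p := by
  refine ⟨?_, ?_, ?_⟩
  · rw [Category.assoc, hm, MonoidalCategory.tensorHom_def, Category.assoc,
      ← comp_whiskerRight_assoc, ho, ← whisker_exchange_assoc, MonObj.one_mul,
      leftUnitor_naturality]
  · rw [Category.assoc, hm, MonoidalCategory.tensorHom_def', Category.assoc,
      ← MonoidalCategory.whiskerLeft_comp_assoc, ho, whisker_exchange_assoc, MonObj.mul_one,
      rightUnitor_naturality]
  · have e₁ : m ▷ P ≫ (p ⊗ₘ p) ≫ μ[B] = ((p ⊗ₘ p) ⊗ₘ p) ≫ μ[B] ▷ B ≫ μ[B] := by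
      rw [← tensorHom_id, tensorHom_comp_tensorHom_assoc, Category.id_comp, hm, comp_tensorHom_eq,
        Category.assoc]
    have e₂ : P ◁ m ≫ (p ⊗ₘ p) ≫ μ[B] = (p ⊗ₘ p ⊗ₘ p) ≫ B ◁ μ[B] ≫ μ[B] := by
      rw [← id_tensorHom, tensorHom_comp_tensorHom_assoc, Category.id_comp, hm, tensorHom_comp_eq,
        Category.assoc]
    rw [Category.assoc, Category.assoc, Category.assoc, hm, e₁, e₂, MonObj.mul_assoc,
      associator_naturality_assoc]

section Product

variable [SymmetricCategory 𝔗] [Preadditive 𝔗] [MonoidalPreadditive 𝔗] [HasBinaryBiproducts 𝔗]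

/-- The product of two algebras. -/
@[reducible]
noncomputable def biprodMonObj (B C : 𝔗) [MonObj B] [MonObj C] : MonObj (B ⊞ C) where
  one := biprod.lift η[B] η[C]
  mul := biprod.lift ((biprod.fst ⊗ₘ biprod.fst) ≫ μ[B]) ((biprod.snd ⊗ₘ biprod.snd) ≫ μ[C])
  one_mul := biprod.hom_ext _ _
    (monObj_axioms_comp (biprod.lift η[B] η[C]) _ _ (biprod.lift_fst _ _)
      (biprod.lift_fst _ _)).1
    (monObj_axioms_comp (biprod.lift η[B] η[C]) _ _ (biprod.lift_snd _ _)
      (biprod.lift_snd _ _)).1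
  mul_one := biprod.hom_ext _ _
    (monObj_axioms_comp (biprod.lift η[B] η[C]) _ _ (biprod.lift_fst _ _)
      (biprod.lift_fst _ _)).2.1
    (monObj_axioms_comp (biprod.lift η[B] η[C]) _ _ (biprod.lift_snd _ _)
      (biprod.lift_snd _ _)).2.1
  mul_assoc := biprod.hom_ext _ _
    (monObj_axioms_comp (biprod.lift η[B] η[C]) _ _ (biprod.lift_fst _ _)
      (biprod.lift_fst _ _)).2.2
    (monObj_axioms_comp (biprod.lift η[B] η[C]) _ _ (biprod.lift_snd _ _)
      (biprod.lift_snd _ _)).2.2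

/-- Étale algebras have products, which are direct sums. -/
theorem Et.exists_prod (B C : Et 𝔗) :
    ∃ (P : Et 𝔗) (q₁ : P ⟶ B) (q₂ : P ⟶ C) (s₁ : B.X ⟶ P.X) (s₂ : C.X ⟶ P.X),
      IsFactor (Et.map q₁) s₁ ∧ IsFactor (Et.map q₂) s₂ ∧
      Et.map q₁ ≫ s₁ + Et.map q₂ ≫ s₂ = 𝟙 P.X ∧
      (∀ {T : Et 𝔗} (f : T ⟶ B) (g : T ⟶ C), ∃ t : T ⟶ P, t ≫ q₁ = f ∧ t ≫ q₂ = g) ∧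
      (∀ {T : Et 𝔗} (f g : T ⟶ P), f ≫ q₁ = g ≫ q₁ → f ≫ q₂ = g ≫ q₂ → f = g) := by
  let := biprodMonObj B.X C.X
  have o₁ : η[B.X ⊞ C.X] ≫ biprod.fst = η[B.X] := biprod.lift_fst _ _
  have o₂ : η[B.X ⊞ C.X] ≫ biprod.snd = η[C.X] := biprod.lift_snd _ _
  have m₁ : μ[B.X ⊞ C.X] ≫ biprod.fst = (biprod.fst ⊗ₘ biprod.fst) ≫ μ[B.X] :=
    biprod.lift_fst _ _
  have m₂ : μ[B.X ⊞ C.X] ≫ biprod.snd = (biprod.snd ⊗ₘ biprod.snd) ≫ μ[C.X] :=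
    biprod.lift_snd _ _
  have : IsCommMonObj (B.X ⊞ C.X) := ⟨by
    refine biprod.hom_ext _ _ ?_ ?_
    · rw [Category.assoc, m₁, ← BraidedCategory.braiding_naturality_assoc, IsCommMonObj.mul_comm]
    · rw [Category.assoc, m₂, ← BraidedCategory.braiding_naturality_assoc, IsCommMonObj.mul_comm]⟩
  have hq₁ : IsMonHom (biprod.fst : B.X ⊞ C.X ⟶ B.X) := ⟨o₁, m₁⟩
  have hq₂ : IsMonHom (biprod.snd : B.X ⊞ C.X ⟶ C.X) := ⟨o₂, m₂⟩
  have f₁ : IsFactor (biprod.fst : B.X ⊞ C.X ⟶ B.X) biprod.inl := by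
    refine ⟨biprod.inl_fst, biprod.hom_ext _ _ ?_ ?_⟩
    · rw [Category.assoc, m₁, MonoidalCategory.tensorHom_def', Category.assoc, Category.assoc,
        Category.assoc, ← MonoidalCategory.whiskerLeft_comp_assoc, biprod.inl_fst]
      simp
    · rw [Category.assoc, m₂, MonoidalCategory.tensorHom_def', Category.assoc, Category.assoc,
        Category.assoc, ← MonoidalCategory.whiskerLeft_comp_assoc, biprod.inl_snd]
      simp
  have f₂ : IsFactor (biprod.snd : B.X ⊞ C.X ⟶ C.X) biprod.inr := by
    refine ⟨biprod.inr_snd, biprod.hom_ext _ _ ?_ ?_⟩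
    · rw [Category.assoc, m₁, MonoidalCategory.tensorHom_def', Category.assoc, Category.assoc,
        Category.assoc, ← MonoidalCategory.whiskerLeft_comp_assoc, biprod.inr_fst]
      simp
    · rw [Category.assoc, m₂, MonoidalCategory.tensorHom_def', Category.assoc, Category.assoc,
        Category.assoc, ← MonoidalCategory.whiskerLeft_comp_assoc, biprod.inr_snd]
      simp
  refine ⟨Et.ofForm (B.X ⊞ C.X) (IsSpecialForm.prod f₁ f₂ biprod.total B.isSpecialForm_trace
    C.isSpecialForm_trace biprod.inl_snd biprod.inr_fst), Et.ofMap biprod.fst hq₁,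
    Et.ofMap biprod.snd hq₂, biprod.inl, biprod.inr, f₁, f₂, biprod.total, ?_, ?_⟩
  · intro T f g
    refine ⟨Et.ofMap (biprod.lift (Et.map f) (Et.map g)) ⟨?_, ?_⟩, Et.hom_ext (biprod.lift_fst _ _),
      Et.hom_ext (biprod.lift_snd _ _)⟩
    · refine biprod.hom_ext _ _ ?_ ?_
      · rw [Category.assoc, biprod.lift_fst, Et.one_map, o₁]
      · rw [Category.assoc, biprod.lift_snd, Et.one_map, o₂]
    · refine biprod.hom_ext _ _ ?_ ?_
      · rw [Category.assoc, biprod.lift_fst, Et.mul_map, Category.assoc, m₁,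
          tensorHom_comp_tensorHom_assoc, biprod.lift_fst]
      · rw [Category.assoc, biprod.lift_snd, Et.mul_map, Category.assoc, m₂,
          tensorHom_comp_tensorHom_assoc, biprod.lift_snd]
  · intro T f g h₁ h₂
    exact Et.hom_ext (biprod.hom_ext _ _ (congrArg Et.map h₁) (congrArg Et.map h₂))

/-- If the étale algebra `B` is the product of `C₁`, `C₂` and `C₃`, it is their direct sum. -/
theorem Et.exists_factors_of_isTernaryCoproduct {B C₁ C₂ C₃ : Et 𝔗} {f₁ : B ⟶ C₁} {f₂ : B ⟶ C₂}
    {f₃ : B ⟶ C₃} (h : IsTernaryCoproduct f₁.op f₂.op f₃.op) :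
    ∃ (s₁ : C₁.X ⟶ B.X) (s₂ : C₂.X ⟶ B.X) (s₃ : C₃.X ⟶ B.X),
      IsFactor (Et.map f₁) s₁ ∧ IsFactor (Et.map f₂) s₂ ∧ IsFactor (Et.map f₃) s₃ ∧
      Et.map f₁ ≫ s₁ + Et.map f₂ ≫ s₂ + Et.map f₃ ≫ s₃ = 𝟙 B.X := by
  obtain ⟨Q, r₂, r₃, t₂, t₃, h₂, h₃, hQ, hQ', hQ''⟩ := Et.exists_prod C₂ C₃
  obtain ⟨P, q₁, q, t₁, t, h₁, hq, hP, hP', hP''⟩ := Et.exists_prod C₁ Q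
  obtain ⟨g, ⟨hg₁, hg₂, hg₃⟩, -⟩ := h q₁.op (q ≫ r₂).op (q ≫ r₃).op
  obtain ⟨k, hk, hk'⟩ := hQ' f₂ f₃
  obtain ⟨m, hm, hm'⟩ := hP' f₁ k
  replace hg₁ : g.unop ≫ f₁ = q₁ := Quiver.Hom.op_inj hg₁
  replace hg₂ : g.unop ≫ f₂ = q ≫ r₂ := Quiver.Hom.op_inj hg₂
  replace hg₃ : g.unop ≫ f₃ = q ≫ r₃ := Quiver.Hom.op_inj hg₃
  have e₁ : g.unop ≫ m = 𝟙 P := by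
    refine hP'' _ _ (by simp [hm, hg₁]) (hQ'' _ _ ?_ ?_)
    · simp [hm', hk, hg₂]
    · simp [hm', hk', hg₃]
  have e₂ : m ≫ g.unop = 𝟙 B := by
    have := (h f₁.op f₂.op f₃.op).unique (y₁ := (m ≫ g.unop).op) (y₂ := 𝟙 _) ?_ (by simp)
    · exact Quiver.Hom.op_inj this
    · refine ⟨Quiver.Hom.unop_inj ?_, Quiver.Hom.unop_inj ?_, Quiver.Hom.unop_inj ?_⟩
      · simp [hg₁, hm]
      · simp [hg₂, reassoc_of% hm', hk]
      · simp [hg₃, reassoc_of% hm', hk']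
  have E₁ : Et.map g.unop ≫ Et.map m = 𝟙 P.X := congrArg Et.map e₁
  have E₂ : Et.map m ≫ Et.map g.unop = 𝟙 B.X := congrArg Et.map e₂
  -- an isomorphism is a direct factor
  have hm₀ : IsFactor (Et.map m) (Et.map g.unop) := by
    refine ⟨E₁, ?_⟩
    have : IsIso (Et.map m) := ⟨Et.map g.unop, E₂, E₁⟩
    rw [← cancel_mono (Et.map m), Category.assoc, Et.mul_map, Category.assoc, Category.assoc, E₁,
      Category.comp_id, MonoidalCategory.tensorHom_def']
    have : B.X ◁ Et.map g.unop ≫ B.X ◁ Et.map m = 𝟙 _ := by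
      rw [← MonoidalCategory.whiskerLeft_comp, E₁, MonoidalCategory.whiskerLeft_id]
    simp only [Category.assoc]
    rw [reassoc_of% this]
  refine ⟨t₁ ≫ Et.map g.unop, (t₂ ≫ t) ≫ Et.map g.unop, (t₃ ≫ t) ≫ Et.map g.unop, ?_, ?_, ?_, ?_⟩
  · rw [← hm]; exact hm₀.comp h₁
  · rw [← hk, ← hm', Category.assoc]; exact hm₀.comp (hq.comp h₂)
  · rw [← hk', ← hm', Category.assoc]; exact hm₀.comp (hq.comp h₃)
  · rw [← hm, ← hk, ← hk', ← hm']
    simp only [Et.map_comp, Category.assoc]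
    have hs : Et.map q₁ ≫ t₁ ≫ Et.map g.unop + Et.map q ≫ (Et.map r₂ ≫ t₂ + Et.map r₃ ≫ t₃) ≫ t ≫
      Et.map g.unop = Et.map g.unop := by
      rw [hQ, Category.id_comp, ← Category.assoc, ← Category.assoc (Et.map q), ←
        Preadditive.add_comp, hP, Category.id_comp]
    have := Et.map m ≫= hs
    rw [E₂] at this
    rw [← this]
    simp [add_assoc]

end Product

end Factors

/-! ### Comparison idempotents of an ordered étale algebra -/

section Comparison

variable {𝔗 : Type u} [Category.{v} 𝔗] [MonoidalCategory 𝔗] [SymmetricCategory 𝔗]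

namespace Et

/-- The idempotent of `B` that cuts out a direct factor `C`, evaluated along `f : B ⟶ T`. -/
abbrev indicator {B C T : Et 𝔗} (s : C.X ⟶ B.X) (f : B ⟶ T) : 𝟙_ 𝔗 ⟶ T.X :=
  η[C.X] ≫ s ≫ map f

theorem indicator_comp {B C T T' : Et 𝔗} (s : C.X ⟶ B.X) (f : B ⟶ T) (g : T ⟶ T') :
    indicator s f ≫ map g = indicator s (f ≫ g) := by
  rw [indicator, indicator, map_comp, Category.assoc, Category.assoc]

theorem indicator_idem {B C T : Et 𝔗} {q : B ⟶ C} {s : C.X ⟶ B.X} (h : IsFactor (map q) s)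
    (f : B ⟶ T) :
    (λ_ (𝟙_ 𝔗)).inv ≫ (indicator s f ⊗ₘ indicator s f) ≫ μ[T.X] = indicator s f := by
  rw [← tensorHom_comp_tensorHom, ← tensorHom_comp_tensorHom, Category.assoc, Category.assoc,
    ← mul_map, reassoc_of% h.tensorHom_mul, MonoidalCategory.tensorHom_def', Category.assoc,
    MonObj.one_mul_assoc, leftUnitor_naturality_assoc, Iso.inv_hom_id_assoc]

theorem indicator_eq_one_iff {B C T : Et 𝔗} {q : B ⟶ C} {s : C.X ⟶ B.X}
    (h : IsFactor (map q) s) (f : B ⟶ T) : indicator s f = η[T.X] ↔ ∃ t : C ⟶ T, q ≫ t = f := by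
  refine ⟨h.exists_lift f, ?_⟩
  rintro ⟨t, rfl⟩
  rw [indicator, map_comp, reassoc_of% h.section_comp, one_map]

/-- An idempotent vanishes as soon as every algebra on which it becomes `1` is zero. -/
theorem eq_zero_of_idem [Preadditive 𝔗] [MonoidalPreadditive 𝔗] [IsIdempotentComplete 𝔗]
    {Z : Et 𝔗} {e : 𝟙_ 𝔗 ⟶ Z.X} (he : (λ_ (𝟙_ 𝔗)).inv ≫ (e ⊗ₘ e) ≫ μ[Z.X] = e)
    (h : ∀ (S : Et 𝔗) (q : Z ⟶ S), e ≫ map q = η[S.X] → IsZero S.X) : e = 0 := by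
  obtain ⟨S, q, s, hq, hs⟩ := Z.exists_factor_of_idem e he
  have hS := h S q (by rw [← hs, Category.assoc, hq.section_comp, Category.comp_id])
  rw [← hs, hS.eq_of_tgt η[S.X] 0, zero_comp]

/-- The multiplication of `A ⊗ B` restricts to the action of `A` on `A ⊗ B`. -/
theorem map_inl_mul (A B : Et 𝔗) :
    map (inl A B) ▷ (A.X ⊗ B.X) ≫ μ[A.X ⊗ B.X] = (α_ _ _ _).inv ≫ μ[A.X] ▷ B.X := by
  have h : (ρ_ A.X).inv ▷ (A.X ⊗ B.X) ≫ tensorμ A.X (𝟙_ 𝔗) A.X B.X ≫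
      (A.X ⊗ A.X) ◁ (λ_ B.X).hom = (α_ _ _ _).inv := by
    rw [tensorμ, braiding_tensorUnit_left]
    monoidal
  have h' := tensorμ_natural (𝟙 A.X) η[B.X] (𝟙 A.X) (𝟙 B.X)
  rw [id_tensorHom, id_tensorHom_id, tensorHom_id, id_tensorHom_id, tensorHom_id,
    id_tensorHom] at h'
  rw [map_inl, tensorObj.mul_def, comp_whiskerRight, Category.assoc, reassoc_of% h',
    MonoidalCategory.tensorHom_def', ← MonoidalCategory.whiskerLeft_comp_assoc, MonObj.one_mul,
    reassoc_of% h]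

/-- The partial trace of the idempotent cutting out a direct factor `C` of `A ⊗ B`. -/
theorem indicator_partialTrace {A B C : Et 𝔗} {q : tensor A B ⟶ C} {s : C.X ⟶ A.X ⊗ B.X}
    (h : IsFactor (map q) s) :
    η[C.X] ≫ s ≫ A.X ◁ B.trace ≫ (ρ_ A.X).hom = gammaTilde (inl A B ≫ q) := by
  apply eq_gammaTilde
  have h₁ : C.trace = s ≫ (tensor A B).trace :=
    trace_eq (h.isSpecialForm (tensor A B).isSpecialForm_trace)
  rw [map_comp, Category.assoc, h₁, trace_tensor, reassoc_of% h.comp_section,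
    rightUnitor_inv_naturality_assoc, Iso.hom_inv_id_assoc, ← whisker_exchange_assoc,
    reassoc_of% map_inl_mul A B, MonoidalCategory.tensorHom_def']
  simp [← whisker_exchange_assoc, unitors_equal]

theorem map_desc_inl_inr {A B T : Et 𝔗} (a : A ⟶ T) :
    map (desc (a ≫ inl T B) (inr T B)) = map a ▷ B.X := by
  have h := map a ▷ B.X ≫= inl_tensor_inr_mul T B
  rwa [Category.comp_id, ← tensorHom_id, tensorHom_comp_tensorHom_assoc, Category.id_comp,
    ← map_comp, ← map_desc, tensorHom_id] at h

theorem desc_comp {A B C D : Et 𝔗} (f : A ⟶ C) (g : B ⟶ C) (h : C ⟶ D) :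
    desc f g ≫ h = desc (f ≫ h) (g ≫ h) := by
  apply tensor_hom_ext
  · rw [← Category.assoc, inl_desc, inl_desc]
  · rw [← Category.assoc, inr_desc, inr_desc]

end Et

namespace OrdEt

variable (A : OrdEt 𝔗)

/-- The tensor square of an ordered étale algebra is the product of `A^(2)`, `A` and `A^(2)`. -/
theorem isTernaryCoproduct :
    IsTernaryCoproduct (Et.desc A.π₁ A.π₂).op (Et.desc (𝟙 A.alg) (𝟙 A.alg)).op
      (Et.desc A.π₂ A.π₁).op := by
  obtain ⟨c, hc, h⟩ := A.total
  let φ : op (Et.tensor A.alg A.alg) ⟶ c.pt :=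
    hc.lift (BinaryFan.mk (Et.inl A.alg A.alg).op (Et.inr A.alg A.alg).op)
  let p₁ : A.alg ⟶ c.pt.unop := Quiver.Hom.unop (X := c.pt) (Y := A.obj) c.fst
  let p₂ : A.alg ⟶ c.pt.unop := Quiver.Hom.unop (X := c.pt) (Y := A.obj) c.snd
  let ψ : c.pt ⟶ op (Et.tensor A.alg A.alg) := (Et.desc p₁ p₂).op
  have h₁ : p₁ ≫ φ.unop = Et.inl A.alg A.alg := congrArg Quiver.Hom.unop
    (isLimit_lift_fst hc (Et.inl A.alg A.alg).op (Et.inr A.alg A.alg).op)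
  have h₂ : p₂ ≫ φ.unop = Et.inr A.alg A.alg := congrArg Quiver.Hom.unop
    (isLimit_lift_snd hc (Et.inl A.alg A.alg).op (Et.inr A.alg A.alg).op)
  have hφ : ∀ {T : Et 𝔗} (f g : A.alg ⟶ T),
      (Et.desc f g).op ≫ φ = hc.lift (BinaryFan.mk f.op g.op) := by
    intro T f g
    refine BinaryFan.IsLimit.hom_ext hc ?_ ?_
    · rw [Category.assoc, isLimit_lift_fst, isLimit_lift_fst]
      exact congrArg Quiver.Hom.op (Et.inl_desc f g)
    · rw [Category.assoc, isLimit_lift_snd, isLimit_lift_snd]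
      exact congrArg Quiver.Hom.op (Et.inr_desc f g)
  have hφψ : φ ≫ ψ = 𝟙 _ := by
    refine Quiver.Hom.unop_inj (Et.tensor_hom_ext ?_ ?_)
    · change Et.inl _ _ ≫ Et.desc p₁ p₂ ≫ φ.unop = Et.inl _ _ ≫ 𝟙 _
      rw [← Category.assoc, Et.inl_desc, h₁, Category.comp_id]
    · change Et.inr _ _ ≫ Et.desc p₁ p₂ ≫ φ.unop = Et.inr _ _ ≫ 𝟙 _
      rw [← Category.assoc, Et.inr_desc, h₂, Category.comp_id]
  intro T f₁ f₂ f₃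
  obtain ⟨g, ⟨h₁, h₂, h₃⟩, hg⟩ := h f₁ f₂ f₃
  refine ⟨φ ≫ g, ⟨?_, ?_, ?_⟩, ?_⟩
  · rw [← Category.assoc, hφ]; exact h₁
  · rw [← Category.assoc, hφ]; exact h₂
  · rw [← Category.assoc, hφ]; exact h₃
  · rintro g' ⟨h₁', h₂', h₃'⟩
    rw [← hg (ψ ≫ g') ⟨?_, ?_, ?_⟩, reassoc_of% hφψ]
    · rw [← h₁']
      change hc.lift (BinaryFan.mk A.π₁.op A.π₂.op) ≫ ψ ≫ g' = _
      rw [← hφ, Category.assoc, reassoc_of% hφψ]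
    · rw [← h₂']
      change hc.lift (BinaryFan.mk (𝟙 A.alg).op (𝟙 A.alg).op) ≫ ψ ≫ g' = _
      rw [← hφ, Category.assoc, reassoc_of% hφψ]
    · rw [← h₃']
      change hc.lift (BinaryFan.mk A.π₂.op A.π₁.op) ≫ ψ ≫ g' = _
      rw [← hφ, Category.assoc, reassoc_of% hφψ]

/-- A decomposition of the tensor square of an ordered étale algebra into the direct factors
`A^(2)`, `A` and `A^(2)` on which the first coordinate is less than, equal to and greater than the
second one, respectively. -/
structure Comparison [Preadditive 𝔗] : Type v where
  /-- the inclusion of the factor on which the first coordinate is the smaller one -/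
  sLt : A.alg₂.X ⟶ (Et.tensor A.alg A.alg).X
  /-- the inclusion of the factor on which the coordinates are equal -/
  sEq : A.alg.X ⟶ (Et.tensor A.alg A.alg).X
  /-- the inclusion of the factor on which the first coordinate is the larger one -/
  sGt : A.alg₂.X ⟶ (Et.tensor A.alg A.alg).X
  isFactor_lt : IsFactor (Et.map (Et.desc A.π₁ A.π₂)) sLt
  isFactor_eq : IsFactor (Et.map (Et.desc (𝟙 A.alg) (𝟙 A.alg))) sEq
  isFactor_gt : IsFactor (Et.map (Et.desc A.π₂ A.π₁)) sGt
  sum_eq : Et.map (Et.desc A.π₁ A.π₂) ≫ sLt + Et.map (Et.desc (𝟙 A.alg) (𝟙 A.alg)) ≫ sEq +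
    Et.map (Et.desc A.π₂ A.π₁) ≫ sGt = 𝟙 _

theorem nonempty_comparison [Preadditive 𝔗] [MonoidalPreadditive 𝔗] [HasBinaryBiproducts 𝔗] :
    Nonempty A.Comparison := by
  obtain ⟨s₁, s₂, s₃, h₁, h₂, h₃, h⟩ := Et.exists_factors_of_isTernaryCoproduct A.isTernaryCoproduct
  exact ⟨⟨s₁, s₂, s₃, h₁, h₂, h₃, h⟩⟩

namespace Comparison

variable [Preadditive 𝔗]

variable {A} (S : A.Comparison) {T : Et 𝔗} (a b : A.alg ⟶ T)

/-- The idempotent cutting out the locus where `a < b`. -/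
noncomputable abbrev lt : 𝟙_ 𝔗 ⟶ T.X := Et.indicator S.sLt (Et.desc a b)

/-- The idempotent cutting out the locus where `a = b`. -/
noncomputable abbrev eq : 𝟙_ 𝔗 ⟶ T.X := Et.indicator S.sEq (Et.desc a b)

/-- The idempotent cutting out the locus where `b < a`. -/
noncomputable abbrev gt : 𝟙_ 𝔗 ⟶ T.X := Et.indicator S.sGt (Et.desc a b)

variable {a b}

theorem lt_eq_one_iff : S.lt a b = η[T.X] ↔ A.rel.Lt a.op b.op := by
  rw [Et.indicator_eq_one_iff S.isFactor_lt]
  constructor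
  · rintro ⟨t, ht⟩
    refine ⟨t.op, ?_, ?_⟩
    · change (A.π₁ ≫ t).op = a.op
      rw [← Et.inl_desc a b, ← ht, ← Category.assoc, Et.inl_desc]
    · change (A.π₂ ≫ t).op = b.op
      rw [← Et.inr_desc a b, ← ht, ← Category.assoc, Et.inr_desc]
  · rintro ⟨t, h₁, h₂⟩
    refine ⟨t.unop, Et.tensor_hom_ext ?_ ?_⟩
    · rw [← Category.assoc, Et.inl_desc, Et.inl_desc]
      exact Quiver.Hom.op_inj h₁
    · rw [← Category.assoc, Et.inr_desc, Et.inr_desc]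
      exact Quiver.Hom.op_inj h₂

theorem gt_eq_one_iff : S.gt a b = η[T.X] ↔ A.rel.Lt b.op a.op := by
  rw [Et.indicator_eq_one_iff S.isFactor_gt]
  constructor
  · rintro ⟨t, ht⟩
    refine ⟨t.op, ?_, ?_⟩
    · change (A.π₁ ≫ t).op = b.op
      rw [← Et.inr_desc a b, ← ht, ← Category.assoc, Et.inr_desc]
    · change (A.π₂ ≫ t).op = a.op
      rw [← Et.inl_desc a b, ← ht, ← Category.assoc, Et.inl_desc]
  · rintro ⟨t, h₁, h₂⟩
    refine ⟨t.unop, Et.tensor_hom_ext ?_ ?_⟩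
    · rw [← Category.assoc, Et.inl_desc, Et.inl_desc]
      exact Quiver.Hom.op_inj h₂
    · rw [← Category.assoc, Et.inr_desc, Et.inr_desc]
      exact Quiver.Hom.op_inj h₁

theorem eq_of_eq_eq_one (h : S.eq a b = η[T.X]) : a = b := by
  obtain ⟨t, ht⟩ := (Et.indicator_eq_one_iff S.isFactor_eq _).1 h
  have h₁ := Et.inl_desc a b
  have h₂ := Et.inr_desc a b
  rw [← ht, ← Category.assoc, Et.inl_desc] at h₁
  rw [← ht, ← Category.assoc, Et.inr_desc] at h₂
  exact h₁.symm.trans h₂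

theorem lt_comp {T' : Et 𝔗} (f : T ⟶ T') : S.lt a b ≫ Et.map f = S.lt (a ≫ f) (b ≫ f) := by
  rw [Et.indicator_comp, Et.desc_comp]

theorem eq_comp {T' : Et 𝔗} (f : T ⟶ T') : S.eq a b ≫ Et.map f = S.eq (a ≫ f) (b ≫ f) := by
  rw [Et.indicator_comp, Et.desc_comp]

theorem gt_comp {T' : Et 𝔗} (f : T ⟶ T') : S.gt a b ≫ Et.map f = S.gt (a ≫ f) (b ≫ f) := by
  rw [Et.indicator_comp, Et.desc_comp]

theorem lt_idem : (λ_ (𝟙_ 𝔗)).inv ≫ (S.lt a b ⊗ₘ S.lt a b) ≫ μ[T.X] = S.lt a b :=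
  Et.indicator_idem S.isFactor_lt _

theorem eq_idem : (λ_ (𝟙_ 𝔗)).inv ≫ (S.eq a b ⊗ₘ S.eq a b) ≫ μ[T.X] = S.eq a b :=
  Et.indicator_idem S.isFactor_eq _

theorem gt_idem : (λ_ (𝟙_ 𝔗)).inv ≫ (S.gt a b ⊗ₘ S.gt a b) ≫ μ[T.X] = S.gt a b :=
  Et.indicator_idem S.isFactor_gt _

theorem sum_eq_one : S.lt a b + S.eq a b + S.gt a b = η[T.X] := by
  have h := η[(Et.tensor A.alg A.alg).X] ≫= S.sum_eq =≫ Et.map (Et.desc a b)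
  simp only [Preadditive.add_comp, Preadditive.comp_add, ← Category.assoc, Et.one_map] at h
  rw [Category.comp_id, Et.one_map] at h
  simpa only [Et.indicator, Category.assoc] using h

/-- Integrating `a < y` over `y`. -/
theorem lt_integral (a : A.alg ⟶ T) :
    S.lt (a ≫ Et.inl T A.alg) (Et.inr T A.alg) ≫ T.X ◁ A.alg.trace ≫ (ρ_ T.X).hom =
      Et.gammaTilde A.π₁ ≫ Et.map a := by
  change (η[A.alg₂.X] ≫ S.sLt ≫ Et.map _) ≫ _ = _
  rw [Et.map_desc_inl_inr, Category.assoc, Category.assoc, ← whisker_exchange_assoc,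
    rightUnitor_naturality, ← Et.inl_desc A.π₁ A.π₂, ← Et.indicator_partialTrace S.isFactor_lt]
  simp only [Category.assoc]

/-- Integrating `a = y` over `y`. -/
theorem eq_integral (a : A.alg ⟶ T) :
    S.eq (a ≫ Et.inl T A.alg) (Et.inr T A.alg) ≫ T.X ◁ A.alg.trace ≫ (ρ_ T.X).hom = η[T.X] := by
  rw [← Et.one_map a, ← Et.gammaTilde_id, ← Et.inl_desc (𝟙 A.alg) (𝟙 A.alg),
    ← Et.indicator_partialTrace S.isFactor_eq]
  change (η[A.alg.X] ≫ S.sEq ≫ Et.map _) ≫ _ = _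
  rw [Et.map_desc_inl_inr, Category.assoc, Category.assoc, ← whisker_exchange_assoc,
    rightUnitor_naturality]
  simp only [Category.assoc]

end Comparison

end OrdEt

end Comparison

/-! ### Finite-like Delannic algebras -/

section Delannic

/-- An isomorphism between the underlying objects of two ordered objects whose orders are initial
objects is an isomorphism of ordered objects. -/
def OrdObj.isoOfIsInitial {C : Type u} [Category.{v} C] {X Y : OrdObj C} (e : X.obj ≅ Y.obj)
    (hX : IsInitial X.rel.carrier) (hY : IsInitial Y.rel.carrier) : X ≅ Y where
  hom := ⟨e.hom, hX.to _, hX.hom_ext _ _, hX.hom_ext _ _⟩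
  inv := ⟨e.inv, hY.to _, hY.hom_ext _ _, hY.hom_ext _ _⟩
  hom_inv_id := OrdHom.ext e.hom_inv_id
  inv_hom_id := OrdHom.ext e.inv_hom_id

variable {𝔗 : Type u} [Category.{v} 𝔗] [MonoidalCategory 𝔗] [SymmetricCategory 𝔗]

/-- An étale algebra whose underlying object is zero is initial in the opposite category. -/
noncomputable def Et.isInitialOp {B : Et 𝔗} (h : IsZero B.X) : IsInitial (op B) :=
  IsInitial.ofUniqueHom
    (fun D => Quiver.Hom.op (Et.ofMap (A := D.unop) (h.from_ D.unop.X)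
      ⟨h.eq_of_tgt _ _, h.eq_of_tgt _ _⟩))
    (fun _ _ => Quiver.Hom.unop_inj (Et.hom_ext (h.eq_of_tgt _ _)))

/-- The invariant of the unit of `A` is the dimension of `A`. -/
theorem Et.gammaTilde_unitHom (A : Et 𝔗) : gammaTilde A.unitHom = η[A.X] ≫ A.trace := by
  symm
  refine eq_gammaTilde (A := one 𝔗) (g := η[A.X] ≫ A.trace) ?_
  rw [trace_one]
  change 𝟙_ 𝔗 ◁ (η[A.X] ≫ A.trace) ≫ (λ_ (𝟙_ 𝔗)).hom ≫ 𝟙 _ = (ρ_ (𝟙_ 𝔗)).hom ≫ η[A.X] ≫ A.trace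
  rw [leftUnitor_naturality_assoc, unitors_equal, Category.comp_id]

/-- Let `e` and `e'` be complementary idempotents. If `u` becomes `1` where `e = 1`, and `0` where
`e' = 1`, then `u = e`. -/
theorem Et.eq_of_idem_add [Preadditive 𝔗] [MonoidalPreadditive 𝔗] [IsIdempotentComplete 𝔗]
    {Z : Et 𝔗} {e e' u : 𝟙_ 𝔗 ⟶ Z.X} (he : (λ_ (𝟙_ 𝔗)).inv ≫ (e ⊗ₘ e) ≫ μ[Z.X] = e)
    (he' : (λ_ (𝟙_ 𝔗)).inv ≫ (e' ⊗ₘ e') ≫ μ[Z.X] = e') (h : e + e' = η[Z.X])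
    (hu : ∀ (S : Et 𝔗) (q : Z ⟶ S), e ≫ map q = η[S.X] → u ≫ map q = η[S.X])
    (hu' : ∀ (S : Et 𝔗) (q : Z ⟶ S), e' ≫ map q = η[S.X] → u ≫ map q = 0) : u = e := by
  obtain ⟨S, q, s, hq, hs⟩ := Z.exists_factor_of_idem e he
  obtain ⟨S', q', s', hq', hs'⟩ := Z.exists_factor_of_idem e' he'
  have hsum : map q ≫ s + map q' ≫ s' = 𝟙 Z.X := by
    rw [hq.comp_section, hq'.comp_section, hs, hs', ← Preadditive.comp_add,
      ← Preadditive.add_comp, ← MonoidalPreadditive.whiskerLeft_add, h, MonObj.mul_one,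
      Iso.inv_hom_id]
  have h₁ := hu S q (by rw [← hs, Category.assoc, hq.section_comp, Category.comp_id])
  have h₂ := hu' S' q' (by rw [← hs', Category.assoc, hq'.section_comp, Category.comp_id])
  rw [← Category.comp_id u, ← hsum, Preadditive.comp_add, reassoc_of% h₁, reassoc_of% h₂, hs,
    zero_comp, add_zero]

namespace OrdEt

/-- Every algebra over which there is a chain of length `n` is zero. -/
def NoChain (A : OrdEt 𝔗) (n : ℕ) : Prop :=
  ∀ {T : Et 𝔗} (a : Fin n → (op T ⟶ A.obj)), A.rel.Increasing a → IsZero T.X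

theorem increasing_snoc (A : OrdEt 𝔗) {n : ℕ} {T : Et 𝔗} {a : Fin (n + 1) → (op T ⟶ A.obj)}
    (ha : A.rel.Increasing a) {b : op T ⟶ A.obj} (hb : A.rel.Lt (a (Fin.last n)) b) :
    A.rel.Increasing (Fin.snoc (α := fun _ => op T ⟶ A.obj) a b : Fin (n + 2) → _) := by
  have := BinRel.Increasing.snoc A.transitive (j := 𝟙 A.obj) (a := a) (b := b)
    (by simpa only [Category.comp_id] using ha) (by simpa only [Category.comp_id] using hb)
  simpa only [Category.comp_id] using this

theorem NoChain.isZero_alg₂ {A : OrdEt 𝔗} (h : A.NoChain 2) : IsZero A.alg₂.X := by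
  refine h ![A.rel.fst, A.rel.snd] fun i j hij => ?_
  obtain ⟨rfl, rfl⟩ : i = 0 ∧ j = 1 := by omega
  exact ⟨𝟙 _, Category.id_comp _, Category.id_comp _⟩

variable [Preadditive 𝔗]

/-- If the order of `A` is zero, then any two `T`-points of `A` agree. -/
theorem eq_eq_one_of_isZero {A : OrdEt 𝔗} (S : A.Comparison) (h : IsZero A.alg₂.X) {T : Et 𝔗}
    (a b : A.alg ⟶ T) : S.eq a b = η[T.X] := by
  have h₀ : ∀ f : A.alg₂.X ⟶ T.X, η[A.alg₂.X] ≫ f = 0 := by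
    intro f
    rw [h.eq_of_tgt η[A.alg₂.X] 0, zero_comp]
  rw [← S.sum_eq_one (a := a) (b := b)]
  change _ = η[A.alg₂.X] ≫ S.sLt ≫ _ + _ + η[A.alg₂.X] ≫ S.sGt ≫ _
  rw [h₀, h₀, zero_add, add_zero]

variable [MonoidalPreadditive 𝔗]

/-- For a chain `a₀ < ⋯ < aₘ₊₁` over `T`, consider the generic point `y` of `A` over `T ⊗ A`.
If only the zero algebra carries longer chains, then `aₘ₊₁ < y` is impossible, and `aₘ < y` is
equivalent to `aₘ₊₁ = y`. Integrating both over `y` gives `c = 0` and `c = 1` in `T`. -/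
theorem NoChain.of_succ [IsIdempotentComplete 𝔗] {k : Type w} [Field k] [Linear k 𝔗]
    {A : OrdEt 𝔗} (S : A.Comparison) {c : k}
    (hc : Et.gammaTilde A.π₁ = c • η[A.alg.X]) {m : ℕ} (h : A.NoChain (m + 3)) :
    A.NoChain (m + 2) := by
  intro T a ha
  let Z := Et.tensor T A.alg
  let x : Fin (m + 2) → (A.alg ⟶ Z) := fun i => (a i).unop ≫ Et.inl T A.alg
  let y : A.alg ⟶ Z := Et.inr T A.alg
  let b := x (Fin.last (m + 1))
  let b' := x (Fin.last m).castSucc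
  have hx' : ∀ {S : Et 𝔗} (q : Z ⟶ S) (i), (x i ≫ q).op = (Et.inl T A.alg ≫ q).op ≫ a i :=
    fun q i => congrArg Quiver.Hom.op (Category.assoc _ _ _)
  have hx : ∀ {S : Et 𝔗} (q : Z ⟶ S), A.rel.Increasing fun i => (x i ≫ q).op := by
    intro S q i j hij
    simp only [hx']
    exact (ha i j hij).precomp _
  have hbb' : ∀ {S : Et 𝔗} (q : Z ⟶ S), A.rel.Lt (b' ≫ q).op (b ≫ q).op :=
    fun q => hx q _ _ (Fin.castSucc_lt_last _)
  -- `b < y` is impossible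
  have h₁ : S.lt b y = 0 := by
    refine Et.eq_zero_of_idem S.lt_idem fun R q hq => ?_
    rw [S.lt_comp, S.lt_eq_one_iff] at hq
    exact h _ (A.increasing_snoc (hx q) hq)
  have e₁ : c • η[T.X] = 0 := by
    have := S.lt_integral (a (Fin.last (m + 1))).unop
    rw [hc, Linear.smul_comp, Et.one_map] at this
    rw [← this]
    exact (h₁ =≫ _).trans zero_comp
  -- `b' < y < b` is impossible
  have h₂ : ∀ {R : Et 𝔗} (q : Z ⟶ R), A.rel.Lt (y ≫ q).op (b ≫ q).op →
      S.lt b' y ≫ Et.map q = 0 := by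
    intro R q hq
    rw [S.lt_comp]
    refine Et.eq_zero_of_idem S.lt_idem fun R' q' hq' => ?_
    rw [S.lt_comp, S.lt_eq_one_iff] at hq'
    have h₃ := hq.precomp q'.op
    have h₄ : A.rel.Increasing fun i : Fin (m + 1) => (x i.castSucc ≫ q ≫ q').op :=
      fun i j hij => hx (q ≫ q') _ _ (by simpa using hij)
    rw [Category.assoc b', Category.assoc y] at hq'
    refine h _ (A.increasing_snoc (A.increasing_snoc h₄ hq') (b := (b ≫ q ≫ q').op) ?_)
    rw [Fin.snoc_last]
    simpa using h₃
  have h₃ : S.lt b' y = S.eq b y := by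
    refine Et.eq_of_idem_add S.eq_idem (S.gt_idem (a := b) (b := y)) ?_
      (fun R q hq => ?_) fun R q hq => h₂ q ?_
    · rw [← S.sum_eq_one (a := b) (b := y), h₁, zero_add]
    · rw [S.eq_comp] at hq
      rw [S.lt_comp, S.lt_eq_one_iff, ← S.eq_of_eq_eq_one hq]
      exact hbb' q
    · rwa [S.gt_comp, S.gt_eq_one_iff] at hq
  have e₂ : c • η[T.X] = η[T.X] := by
    have := S.lt_integral (a (Fin.last m).castSucc).unop
    rw [hc, Linear.smul_comp, Et.one_map] at this
    rw [← this, ← S.eq_integral (a (Fin.last (m + 1))).unop]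
    exact h₃ =≫ _
  exact Et.isZero_of_one_eq_zero (e₂.symm.trans e₁)

theorem NoChain.of_add [IsIdempotentComplete 𝔗] {k : Type w} [Field k] [Linear k 𝔗]
    {A : OrdEt 𝔗} (S : A.Comparison) {c : k}
    (hc : Et.gammaTilde A.π₁ = c • η[A.alg.X]) {m : ℕ} (h : A.NoChain (m + 2)) :
    A.NoChain 2 := by
  induction m with
  | zero => exact h
  | succ m ih => exact ih (NoChain.of_succ S hc h)

/-- If `A^(n) = 0`, there are no chains of length `n` or more. The bound `n + 2` is convenient for
a descent to length `2`. -/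
theorem noChain_of_powerIsZero [HasZeroObject 𝔗] {A : OrdEt 𝔗} {n : ℕ} (h : A.PowerIsZero n) :
    A.NoChain (n + 2) := by
  obtain ⟨E, x, hx, ⟨hE⟩⟩ := h
  intro T a ha
  obtain ⟨t, -, -⟩ := hx.existsUnique_lift (fun i => a (Fin.castAdd 2 i))
    fun i j hij => ha _ _ hij
  exact Et.isZero_of_zero_hom (t ≫ hE.to (op (Et.zero 𝔗))).unop

/-- If the order of `A` is zero, then `η` and the trace of `A` are inverse isomorphisms: the two
inclusions of `A` in `A ⊗ A` agree, and their partial traces are the dimension of `A` and the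
composition of the trace with `η`, respectively. -/
theorem nonempty_iso_one [HasZeroObject 𝔗] {k : Type w} [Field k] [Linear k 𝔗] [MonoidalLinear k 𝔗]
    {A : OrdEt 𝔗} (S : A.Comparison) (h : IsZero A.alg₂.X) (hA : ¬ IsZero A.alg.X)
    {c : k} (hc : Et.gammaTilde A.alg.unitHom = c • η[(Et.one 𝔗).X]) :
    Nonempty (A ≅ OrdEt.one 𝔗) := by
  replace hc : η[A.alg.X] ≫ A.alg.trace = c • 𝟙 (𝟙_ 𝔗) := A.alg.gammaTilde_unitHom.symm.trans hc
  have hl : Et.map (Et.inl A.alg A.alg) ≫ A.alg.X ◁ A.alg.trace ≫ (ρ_ _).hom = c • 𝟙 A.alg.X := by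
    rw [Et.map_inl, Category.assoc, ← MonoidalCategory.whiskerLeft_comp_assoc, hc,
      MonoidalLinear.whiskerLeft_smul]
    simp
  have hr : Et.map (Et.inr A.alg A.alg) ≫ A.alg.X ◁ A.alg.trace ≫ (ρ_ _).hom =
      A.alg.trace ≫ η[A.alg.X] := by
    rw [Et.map_inr, Category.assoc, ← whisker_exchange_assoc, rightUnitor_naturality,
      ← unitors_equal]
    simp
  have heq := eq_eq_one_of_isZero S h (Et.inl A.alg A.alg) (Et.inr A.alg A.alg)
  rw [S.eq_of_eq_eq_one heq, hr] at hl
  have h₂ : c • η[A.alg.X] = η[A.alg.X] := by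
    have := S.eq_integral (𝟙 A.alg)
    rw [Category.id_comp, heq, ← Et.one_map (Et.inr A.alg A.alg), Category.assoc, hr, hl,
      Linear.comp_smul, Category.comp_id] at this
    exact this
  have hc₁ : c = 1 := by
    have h₃ : (c - 1) • η[A.alg.X] = 0 := by rw [sub_smul, h₂, one_smul, sub_self]
    exact sub_eq_zero.1 ((smul_eq_zero.1 h₃).resolve_right fun h₀ =>
      hA (Et.isZero_of_one_eq_zero h₀))
  rw [hc₁, one_smul] at hl hc
  have hmon : IsMonHom A.alg.trace := by
    refine ⟨hc, ?_⟩
    have h₃ : (A.alg.trace ⊗ₘ A.alg.trace) ≫ (η[A.alg.X] ⊗ₘ η[A.alg.X]) = 𝟙 _ := by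
      rw [tensorHom_comp_tensorHom, hl, id_tensorHom_id]
    rw [← Category.id_comp μ[A.alg.X], ← h₃, Category.assoc, Category.assoc,
      ← reassoc_of% (isMonHom_one A.alg.X).mul_hom, hc, Category.comp_id]
  let e : A.obj ≅ op (Et.one 𝔗) :=
    { hom := A.alg.unitHom.op
      inv := (Et.ofMap (B := Et.one 𝔗) A.alg.trace hmon).op
      hom_inv_id := Quiver.Hom.unop_inj (Et.hom_ext hl)
      inv_hom_id := Quiver.Hom.unop_inj (Et.hom_ext hc) }
  exact ⟨OrdObj.isoOfIsInitial e (Et.isInitialOp h) (Et.isInitialZero 𝔗)⟩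

theorem nonempty_iso_zero [HasZeroObject 𝔗] {A : OrdEt 𝔗} (h : IsZero A.alg.X) :
    Nonempty (A ≅ OrdEt.zero 𝔗) := by
  have h₂ : IsZero A.alg₂.X := by
    refine Et.isZero_of_one_eq_zero ?_
    rw [← Et.one_map A.π₁, h.eq_of_tgt η[A.alg.X] 0, zero_comp]
  exact ⟨OrdObj.isoOfIsInitial ((Et.isInitialOp h).uniqueUpToIso (Et.isInitialZero 𝔗))
    (Et.isInitialOp h₂) (Et.isInitialZero 𝔗)⟩

theorem nonempty_iso_zero_or_one [HasFiniteBiproducts 𝔗] [IsIdempotentComplete 𝔗]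
    {k : Type w} [Field k] [Linear k 𝔗] [MonoidalLinear k 𝔗] {A : OrdEt 𝔗} (hA : A.IsFiniteLike)
    (hA' : A.IsDelannic k) : Nonempty (A ≅ OrdEt.zero 𝔗) ∨ Nonempty (A ≅ OrdEt.one 𝔗) := by
  rcases hA' with h | ⟨⟨-, c', hc'⟩, ⟨h, c, hc⟩, -⟩
  · exact Or.inl (nonempty_iso_zero h)
  · obtain ⟨n, hn⟩ := hA
    have := hasBinaryBiproducts_of_finite_biproducts 𝔗
    obtain ⟨S⟩ := A.nonempty_comparison
    have h₂ := NoChain.isZero_alg₂ (NoChain.of_add S hc (noChain_of_powerIsZero hn))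
    exact Or.inr (nonempty_iso_one S h₂ h hc')

end OrdEt

end Delannic

end OrderedEtale

theorem mainTheorem12 :
    (∀ (C : Type u₁) [Category.{v₁} C] [FinitaryExtensive C] [HasFiniteLimits C],
      OrderedEtale.HasComplements C →
      ∀ (X : OrderedEtale.OrdObj C) (n : ℕ),
        X.PowerIsZero (n + 1) ↔
          ∃ Y : Fin n → Subobject (⊤_ C), Antitone Y ∧
            ∃ inc : ∀ i, (OrderedEtale.subterminalOrd (Y i)).obj ⟶ X.obj,
              OrderedEtale.IsLexSum X (fun i => OrderedEtale.subterminalOrd (Y i)) inc) ∧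
    (∀ (k : Type w) [Field k] (𝔗 : Type u₂) [Category.{v₂} 𝔗] [Preadditive 𝔗] [Linear k 𝔗]
      [HasFiniteBiproducts 𝔗] [IsIdempotentComplete 𝔗]
      [MonoidalCategory 𝔗] [SymmetricCategory 𝔗] [MonoidalPreadditive 𝔗] [MonoidalLinear k 𝔗]
      (A : OrderedEtale.OrdEt 𝔗),
        A.IsFiniteLike → OrderedEtale.OrdEt.IsDelannic k A →
          Nonempty (A ≅ OrderedEtale.OrdEt.zero 𝔗) ∨
            Nonempty (A ≅ OrderedEtale.OrdEt.one 𝔗)) :=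
  ⟨fun _ _ _ _ hC X n => X.powerIsZero_iff_exists_isLexSum hC n,
    fun _ _ _ _ _ _ _ _ _ _ _ _ _ hA hA' => OrderedEtale.OrdEt.nonempty_iso_zero_or_one hA hA'⟩
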